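/- Let $p>2$ be a prime, let $q$ be a power of $p$, and put $K=\overline{\mathbb F}_q$. Let $\mathcal X\subset\mathbb P^2(K)$ be a geometrically irreducible projective plane curve defined over $\mathbb F_q$, given by a homogeneous polynomial $F(X_0,X_1,X_2)\in\mathbb F_q[X_0,X_1,X_2]$ that is irreducible over $K$, and assume that $\mathcal X$ is not a line. Let $\gamma:\mathcal X\to\mathcal X'$ be its Gauss map, which sends a nonsingular point to its tangent line, so that $\gamma=(\partial F/\partial X_0:\partial F/\partial X_1:\partial F/\partial X_2)$. Let $p^r$ be the inseparable degree of $\gamma$, and write $\gamma=\Phi_{p^r}\circ\gamma_s$, where $\Phi_{p^r}$ is the $p^r$-Frobenius map on coordinates and $\gamma_s$ is separable. Let $G$ be a nontrivial group of automorphisms of $\mathcal X$ that are induced by projective transformations of $\mathbb P^2(K)$. Suppose that $\gamma_s(\mathcal X)$ is a subcover of the quotient curve $\mathcal X/G$, that is, $K(\gamma_s(\mathcal X))\subseteq K(\mathcal X)^G$. Suppose also that $G$ is finite, of order $n$ with $p\nmid n$. Then $r>0$ and, after a projective transformation over $K$, with affine coordinates $x,y$ in the new system, the following hold. The curve $\mathcal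 X$ is defined by an irreducible polynomial $f\in K[x,y]$ that divides a polynomial of the form $$z_1(x^n,y)^{p^r}\,y+z_2(x^n,y)^{p^r},\qquad z_1,z_2\in K[x,y],$$ where $z_1(x^n,y)$ does not vanish identically on $\mathcal X$ (that is, $f\nmid z_1(x^n,y)$). Moreover $G=\langle\sigma\rangle$ is cyclic, where $\sigma:(x,y)\mapsto(\xi x,y)$ for a primitive $n$-th root of unity $\xi\in K$. -/

import Mathlib

open MvPolynomial

noncomputable section

/-- A (geometrically irreducible, projective) plane curve defined over `k`, seen in the projective
plane over `K`: a homogeneous polynomial in three variables over `k` that is irreducible over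
`K`. -/
structure PlaneCurve (k K : Type*) [Field k] [Field K] [Algebra k K] where
  /-- the defining polynomial, with coefficients in `k` -/
  poly : MvPolynomial (Fin 3) k
  /-- the degree of the curve -/
  degree : ℕ
  homogeneous : poly.IsHomogeneous degree
  irreducible : Irreducible (MvPolynomial.map (algebraMap k K) poly)

/-- The field `K(v₀ : v₁ : v₂)` generated over `K` by the ratios `v i / v j`.  If the `v i` are
elements, not all zero, of the function field of a curve, it is the function field of the image of
the curve under the rational map `(v₀ : v₁ : v₂)`. -/
def ratioField (K : Type*) {E : Type*} [Field K] [Field E] [Algebra K E] (v : Fin 3 → E) :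
    IntermediateField K E :=
  IntermediateField.adjoin K {f : E | ∃ i j : Fin 3, f = v i / v j}

theorem div_mem_ratioField {K E : Type*} [Field K] [Field E] [Algebra K E] (v : Fin 3 → E)
    (i j : Fin 3) : v i / v j ∈ ratioField K v :=
  IntermediateField.subset_adjoin K _ ⟨i, j, rfl⟩

theorem linear_div_linear_mem_ratioField {K E : Type*} [Field K] [Field E] [Algebra K E]
    (v : Fin 3 → E) (a b : Fin 3 → K) :
    (∑ k, algebraMap K E (a k) * v k) / (∑ k, algebraMap K E (b k) * v k) ∈ ratioField K v := by
  by_cases h : ∀ k, v k = 0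
  · simp [h, zero_mem]
  · push Not at h
    obtain ⟨m, hm⟩ := h
    have key : ∀ c : Fin 3 → K,
        (∑ k, algebraMap K E (c k) * v k) / v m ∈ ratioField K v := by
      intro c
      rw [Finset.sum_div]
      refine sum_mem fun k _ => ?_
      rw [mul_div_assoc]
      exact mul_mem ((ratioField K v).algebraMap_mem (c k)) (div_mem_ratioField v k m)
    have := div_mem (key a) (key b)
    rwa [div_div_div_cancel_right₀ hm] at this

namespace PlaneCurve

variable {k K : Type*} [Field k] [Field K] [Algebra k K] (C : PlaneCurve k K)

/-- The defining polynomial, with coefficients in `K`. -/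
def polyK : MvPolynomial (Fin 3) K := MvPolynomial.map (algebraMap k K) C.poly

/-- The homogeneous coordinate ring `K[X₀, X₁, X₂] / (F)` of the curve. -/
abbrev CoordRing : Type _ := MvPolynomial (Fin 3) K ⧸ Ideal.span {C.polyK}

instance instIsDomainCoordRing : IsDomain C.CoordRing := by
  have hp : Prime C.polyK := C.irreducible.prime
  have : (Ideal.span {C.polyK}).IsPrime :=
    (Ideal.span_singleton_prime hp.ne_zero).2 hp
  exact Ideal.Quotient.isDomain _

/-- The field of fractions of the homogeneous coordinate ring. -/
abbrev CoordField : Type _ := FractionRing C.CoordRing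

/-- The class of a homogeneous polynomial in the field of fractions of the coordinate ring. -/
def cls (P : MvPolynomial (Fin 3) K) : C.CoordField :=
  algebraMap C.CoordRing C.CoordField (Ideal.Quotient.mk _ P)

/-- The homogeneous coordinate functions of the curve. -/
def coord (i : Fin 3) : C.CoordField := C.cls (X i)

/-- The function field `K(𝒳)`: the subfield of degree-zero elements of the field of fractions of
the coordinate ring, generated over `K` by the ratios of the coordinate functions. -/
abbrev functionField : IntermediateField K C.CoordField := ratioField K C.coord

/-- For a matrix `A`, the rational function `(A X)ᵢ / (A X)ⱼ` on the curve, where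
`X = (X₀, X₁, X₂)` is the vector of the homogeneous coordinates. -/
def linRatio (A : Matrix (Fin 3) (Fin 3) K) (i j : Fin 3) : C.functionField :=
  ⟨(∑ l, algebraMap K C.CoordField (A i l) * C.coord l) /
      (∑ l, algebraMap K C.CoordField (A j l) * C.coord l),
    linear_div_linear_mem_ratioField C.coord (A i) (A j)⟩

/-- An automorphism of the curve, given as a `K`-automorphism of its function field, is linear if
it is induced by a projective transformation `X ↦ A X` of the plane. -/
def IsLinear (σ : C.functionField ≃ₐ[K] C.functionField) : Prop :=
  ∃ A : GL (Fin 3) K, ∀ i j : Fin 3,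
    σ (C.linRatio 1 i j) = C.linRatio (A : Matrix (Fin 3) (Fin 3) K) i j

/-- The Gauss map `γ = (∂F/∂X₀ : ∂F/∂X₁ : ∂F/∂X₂)` in homogeneous coordinates: it sends a
nonsingular point `P` to the tangent line `∑ᵢ (∂F/∂Xᵢ)(P) Xᵢ = 0`, which is the osculating
hyperplane of a plane curve at `P`. -/
def gaussMap (i : Fin 3) : C.CoordField := C.cls (pderiv i C.polyK)

/-- `γ = Φ_{p^r} ∘ γ_s` with `γ_s = (z₀ : z₁ : z₂)` separable: the points
`(z₀^(p^r) : z₁^(p^r) : z₂^(p^r))` and `γ` coincide, and the function field of the curve is a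
separable (algebraic) extension of the function field `K(z₀ : z₁ : z₂)` of `γ_s(𝒳)`. -/
def IsSeparableGaussMap (p r : ℕ) (z : Fin 3 → C.functionField) : Prop :=
  (∃ c : C.CoordField, c ≠ 0 ∧ ∀ i, ((z i : C.functionField) : C.CoordField) ^ p ^ r
      = c * C.gaussMap i) ∧
    Algebra.IsSeparable (ratioField K z) C.functionField

/-- The affine equation `f(x, y) = F(T (x, y, 1))` of the curve in the new homogeneous coordinates
`X' = T⁻¹ X`, in the chart `X'₂ ≠ 0`, where `x = X'₀ / X'₂` and `y = X'₁ / X'₂`. -/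
def affinePoly (T : GL (Fin 3) K) : MvPolynomial (Fin 2) K :=
  aeval (fun i => ∑ j, MvPolynomial.C ((T : Matrix (Fin 3) (Fin 3) K) i j) *
    (![X 0, X 1, 1] : Fin 3 → MvPolynomial (Fin 2) K) j) C.polyK

end PlaneCurve

/-- The polynomial `g(x^n, y)`. -/
def substPow {K : Type*} [Field K] (n : ℕ) (g : MvPolynomial (Fin 2) K) :
    MvPolynomial (Fin 2) K :=
  aeval (![X 0 ^ n, X 1] : Fin 2 → MvPolynomial (Fin 2) K) g

end

noncomputable section

/-! Let σ ∈ G be induced by a matrix A. It fixes γ_s, hence γ. Applying σ^m to the incidence of the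
generic point P with its tangent line (Euler's identity) shows that A^m P lies on the tangent line
at P for every m (`sum_gaussMap_mul_linMap`). Since σ^n = 1 and p ∤ n, A^n is scalar and A is
diagonalisable. In an eigenbasis the incidences read ∑ g_i d_i^m = 0, where g_i is the product of
the i-th coordinates of P and of its tangent line. The coordinates of P are nonzero because the
curve is not a line, so a Vandermonde argument leaves one possibility: A is scalar or a homology
whose centre lies on every tangent line (`exists_homology`).

The Gauss map is not constant, since otherwise K(𝒳) would be algebraic over K, hence equal to K, and
G trivial (`gaussMap_not_constant`). So at most one point lies on all tangent lines, and the
homologies share their centre; put it at (1:0:0). Then G acts by (s, y) ↦ (as + by + c, y). The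
character σ ↦ a is injective because a nontrivial translation cannot have order dividing n, so G is
cyclic, and a shear makes a generator diagonal (`exists_generator_of_affine`).

Tangent lines through (1:0:0) have no x-term. After p^r-th roots of constants are taken, the tangent
equation at P reads w₁^(p^r) y + w₂^(p^r) = 0 with w₁, w₂ ∈ K(γ_s(𝒳)) ⊆ K(𝒳)^G = K(x^n, y)
(`exists_tangent_equation`, `mem_adjoin_pow_of_fixed`); clearing denominators gives z₁ and z₂.

For r > 0, note that the derivative of F towards the centre vanishes on the curve, so
differentiation in that direction descends to the coordinate field. It kills y. If r = 0, then
K(γ_s(𝒳)) ⊆ K(y), and separability forces it to kill x as well, which is absurd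
(`pos_of_tangentCoord_eq_zero`). -/

/-! ### Linear algebra: diagonalisation and a Vandermonde argument -/

theorem exists_algebraMap_eq_of_aeval_eq_zero {K E : Type*} [Field K] [IsAlgClosed K] [Field E]
    [Algebra K E] {h : E} {P : Polynomial K} (hP : P ≠ 0) (hh : Polynomial.aeval h P = 0) :
    ∃ c : K, algebraMap K E c = h := by
  have hi : IsIntegral K h := isAlgebraic_iff_isIntegral.1 ⟨P, hP, hh⟩
  have := minpoly.mem_range_of_degree_eq_one K h
    (IsAlgClosed.degree_eq_one_of_irreducible K (minpoly.irreducible hi))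
  exact this

/-- X^m - c is separable when m and c are nonzero in K, so `f` is semisimple, and over an
algebraically closed field its eigenvectors span. -/
theorem exists_basis_eigenvectors {K V : Type*} [Field K] [IsAlgClosed K] [AddCommGroup V]
    [Module K V] [FiniteDimensional K V] (f : Module.End K V) {m : ℕ} (hm : (m : K) ≠ 0) {c : K}
    (hc : c ≠ 0) (h : f ^ m = algebraMap K _ c) :
    ∃ (b : Module.Basis (Fin (Module.finrank K V)) K V) (d : Fin (Module.finrank K V) → K),
      ∀ i, f (b i) = d i • b i := by
  have hsq : Squarefree (Polynomial.X ^ m - Polynomial.C c : Polynomial K) :=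
    (Polynomial.separable_X_pow_sub_C c hm hc).squarefree
  have hss : f.IsSemisimple :=
    Module.End.isSemisimple_of_squarefree_aeval_eq_zero hsq (by simp [h])
  have htop : ⨆ μ : K, f.eigenspace μ = ⊤ := by
    rw [← Module.End.iSup_maxGenEigenspace_eq_top f]
    congr 1
    ext1 μ
    exact (hss.isFinitelySemisimple.maxGenEigenspace_eq_eigenspace μ).symm
  have hspan : ⊤ ≤ Submodule.span K {v : V | ∃ μ : K, f v = μ • v} := by
    rw [← htop]
    refine iSup_le fun μ v hv => Submodule.subset_span ⟨μ, Module.End.mem_eigenspace_iff.1 hv⟩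
  -- `ofSpan` picks its vectors from the spanning set, so they are eigenvectors.
  let b₀ := Module.Basis.ofSpan hspan
  have hmem : ∀ i, ∃ μ : K, f (b₀ i) = μ • b₀ i := fun i =>
    Module.Basis.ofSpan_subset hspan ⟨i, rfl⟩
  have : Fintype ((linearIndepOn_empty K id).extend (Set.empty_subset _) : Set V) :=
    FiniteDimensional.fintypeBasisIndex b₀
  let b := b₀.reindex (Fintype.equivFinOfCardEq (Module.finrank_eq_card_basis b₀).symm)
  have hb : ∀ i, ∃ μ : K, f (b i) = μ • b i := fun i => by
    simpa [b] using hmem _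
  choose d hd using hb
  exact ⟨b, d, hd⟩

theorem exists_conj_diagonal {K : Type*} [Field K] [IsAlgClosed K] (A : Matrix (Fin 3) (Fin 3) K)
    {m : ℕ} (hm : (m : K) ≠ 0) {c : K} (hc : c ≠ 0) (h : A ^ m = Matrix.scalar (Fin 3) c) :
    ∃ (S : GL (Fin 3) K) (d : Fin 3 → K),
      A * (S : Matrix (Fin 3) (Fin 3) K) = S * Matrix.diagonal d := by
  have h' : (Matrix.toLin' A) ^ m = algebraMap K _ c := by
    rw [← Matrix.toLin'_pow, h]
    ext v i
    simp [Matrix.scalar_apply, Module.algebraMap_end_apply, Matrix.diagonal, Matrix.of_apply, Pi.single_apply]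
  obtain ⟨b₀, d₀, hb₀⟩ := exists_basis_eigenvectors _ hm hc h'
  have e3 : Module.finrank K (Fin 3 → K) = 3 := by simp
  obtain ⟨b, d, hb⟩ : ∃ (b : Module.Basis (Fin 3) K (Fin 3 → K)) (d : Fin 3 → K),
      ∀ i, A.mulVec (b i) = d i • b i :=
    ⟨b₀.reindex (finCongr e3), d₀ ∘ (finCongr e3).symm, fun i => by
      simpa using hb₀ ((finCongr e3).symm i)⟩
  let S : Matrix (Fin 3) (Fin 3) K := (Pi.basisFun K (Fin 3)).toMatrix b
  have hS : IsUnit S.det := by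
    rw [← Matrix.isUnit_iff_isUnit_det]
    have := (Pi.basisFun K (Fin 3)).invertibleToMatrix b
    exact isUnit_of_invertible S
  refine ⟨Matrix.GeneralLinearGroup.mk'' S hS, d, ?_⟩
  ext i j
  have := congrFun (hb j) i
  simp only [Matrix.mulVec, dotProduct, Pi.smul_apply, smul_eq_mul] at this
  have hval : ((Matrix.GeneralLinearGroup.mk'' S hS : GL (Fin 3) K) :
      Matrix (Fin 3) (Fin 3) K) = S := rfl
  rw [hval, Matrix.mul_diagonal, Matrix.mul_apply]
  change ∑ l, A i l * b j l = b j i * d j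
  rw [this, mul_comm]

/-- Three-term Vandermonde relations force two of the nodes to agree. -/
theorem vandermonde_three_degenerate {E : Type*} [Field E] {g d : Fin 3 → E} (hg : g ≠ 0)
    (h : ∀ k : ℕ, ∑ i, g i * d i ^ k = 0) :
    ∃ j, (∀ i l, i ≠ j → l ≠ j → d i = d l) ∧ ∀ i, i ≠ j → d i = d j ∨ g j = 0 := by
  have h0 := h 0
  have h1 := h 1
  have h2 := h 2
  simp only [Fin.sum_univ_three, pow_zero, mul_one, pow_one] at h0 h1 h2
  -- For each i, the monic quadratic vanishing at the two other nodes supplies the coefficients that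
  -- combine the relations for k = 0, 1, 2 and isolate g_i.
  have key : (d 0 - d 1) * (d 0 - d 2) * g 0 = 0 ∧ (d 1 - d 0) * (d 1 - d 2) * g 1 = 0 ∧
      (d 2 - d 0) * (d 2 - d 1) * g 2 = 0 := by
    refine ⟨?_, ?_, ?_⟩
    · linear_combination h2 - (d 1 + d 2) * h1 + d 1 * d 2 * h0
    · linear_combination h2 - (d 0 + d 2) * h1 + d 0 * d 2 * h0
    · linear_combination h2 - (d 0 + d 1) * h1 + d 0 * d 1 * h0
  obtain ⟨k0, k1, k2⟩ := key
  simp only [mul_eq_zero, sub_eq_zero] at k0 k1 k2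
  by_cases e01 : d 0 = d 1
  · refine ⟨2, ?_, ?_⟩
    · intro i l hi hl; fin_cases i <;> fin_cases l <;> simp_all
    · intro i hi; fin_cases i <;> simp_all <;> grind
  by_cases e02 : d 0 = d 2
  · refine ⟨1, ?_, ?_⟩
    · intro i l hi hl; fin_cases i <;> fin_cases l <;> simp_all
    · intro i hi; fin_cases i <;> simp_all <;> grind
  by_cases e12 : d 1 = d 2
  · refine ⟨0, ?_, ?_⟩
    · intro i l hi hl; fin_cases i <;> fin_cases l <;> simp_all
    · intro i hi; fin_cases i <;> simp_all
  · exfalso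
    apply hg
    ext i
    fin_cases i <;> simp <;> grind

/-! ### Automorphisms of a field K(s, y): affine groups and invariants -/

theorem algEquiv_eq_of_adjoin_eq_top {K L : Type*} [Field K] [Field L] [Algebra K L] {s y : L}
    (htop : IntermediateField.adjoin K {s, y} = ⊤) {σ τ : L ≃ₐ[K] L} (hs : σ s = τ s)
    (hy : σ y = τ y) : σ = τ := by
  have h : IntermediateField.adjoin K {s, y} ≤
      IntermediateField.fixedField (Subgroup.zpowers (τ⁻¹ * σ)) := by
    rw [IntermediateField.adjoin_le_iff]
    have : ∀ x : L, σ x = τ x →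
        x ∈ IntermediateField.fixedField (Subgroup.zpowers (τ⁻¹ * σ)) := by
      intro x hx
      rw [IntermediateField.mem_fixedField_iff]
      have h1 : (τ⁻¹ * σ) ∈ MulAction.stabilizer (L ≃ₐ[K] L) x := by
        rw [MulAction.mem_stabilizer_iff]
        change τ.symm (σ x) = x
        rw [hx, AlgEquiv.symm_apply_apply]
      intro f hf
      exact (Subgroup.zpowers_le.2 h1) hf
    rintro x (rfl | rfl)
    · exact this _ hs
    · exact this _ hy
  ext x
  have hx : x ∈ IntermediateField.adjoin K {s, y} := htop ▸ IntermediateField.mem_top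
  have := (IntermediateField.mem_fixedField_iff _ _).1 (h hx) _ (Subgroup.mem_zpowers _)
  change τ.symm (σ x) = x at this
  exact (AlgEquiv.symm_apply_eq τ).1 this

/-- A finite group, of order prime to the characteristic, of affine transformations
`(s, y) ↦ (a s + b y + c, y)` is generated by a diagonal one, in suitable coordinates. -/
theorem exists_generator_of_affine {K L : Type*} [Field K] [Field L] [Algebra K L] {s y : L}
    (htop : IntermediateField.adjoin K {s, y} = ⊤)
    (hind : ∀ a b c : K, a • s + b • y + algebraMap K L c = 0 → a = 0 ∧ b = 0 ∧ c = 0)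
    (G : Subgroup (L ≃ₐ[K] L)) (hG : G ≠ ⊥) {n : ℕ} (hn : Nat.card G = n) (hnK : (n : K) ≠ 0)
    (hy : ∀ σ ∈ G, σ y = y)
    (hs : ∀ σ ∈ G, ∃ a b c : K, σ s = a • s + b • y + algebraMap K L c) :
    ∃ (σ : L ≃ₐ[K] L) (ξ b c : K), G = Subgroup.zpowers σ ∧ IsPrimitiveRoot ξ n ∧
      σ (s + b • y + algebraMap K L c) = ξ • (s + b • y + algebraMap K L c) := by
  have hn0 : n ≠ 0 := by rintro rfl; simp at hnK
  have : Finite G := Nat.finite_of_card_ne_zero (hn ▸ hn0)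
  choose! a b c habc using hs
  have uniq : ∀ {a b c a' b' c' : K}, a • s + b • y + algebraMap K L c =
      a' • s + b' • y + algebraMap K L c' → a = a' ∧ b = b' ∧ c = c' := by
    intro a b c a' b' c' h
    have := hind (a - a') (b - b') (c - c') (by
      rw [map_sub, sub_smul, sub_smul]; linear_combination h)
    simpa [sub_eq_zero] using this
  have hone : a 1 = 1 ∧ b 1 = 0 ∧ c 1 = 0 := by
    apply uniq
    rw [← habc 1 G.one_mem]
    simp
  have hmul : ∀ σ ∈ G, ∀ τ ∈ G, a (σ * τ) = a σ * a τ := by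
    intro σ hσ τ hτ
    have h1 := habc _ (G.mul_mem hσ hτ)
    have h2 : (σ * τ) s = (a τ * a σ) • s + (a τ * b σ + b τ) • y +
        algebraMap K L (a τ * c σ + c τ) := by
      change σ (τ s) = _
      rw [habc τ hτ]
      simp only [map_add, map_smul, hy σ hσ, AlgEquiv.commutes, habc σ hσ]
      simp only [Algebra.smul_def, map_add, map_mul]
      ring
    rw [h1] at h2
    rw [(uniq h2).1, mul_comm]
  let χ : G →* K :=
    { toFun := fun σ => a σ
      map_one' := hone.1
      map_mul' := fun σ τ => hmul _ σ.2 _ τ.2 }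
  -- With a = 1, σ is a translation s ↦ s + v with v fixed, so σ^n = 1 gives n v = 0, and n is
  -- invertible.
  have hker : ∀ σ ∈ G, a σ = 1 → σ = 1 := by
    intro σ hσ h1
    set v : L := b σ • y + algebraMap K L (c σ) with hv
    have hσs : σ s = s + v := by rw [habc σ hσ, h1, one_smul, hv, add_assoc]
    have hσv : σ v = v := by simp [hv, hy σ hσ]
    have hpow : ∀ k : ℕ, (σ ^ k) s = s + (k : L) * v := by
      intro k
      induction k with
      | zero => simp
      | succ k ih =>
        rw [pow_succ']
        change σ ((σ ^ k) s) = _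
        rw [ih]
        simp only [map_add, map_mul, map_natCast, hσv, hσs]
        push_cast
        ring
    have hcard : σ ^ n = 1 := by
      have := pow_card_eq_one' (x := (⟨σ, hσ⟩ : G))
      rw [hn] at this
      simpa using congrArg Subtype.val this
    have h3 := hpow n
    rw [hcard] at h3
    have hnL : (n : L) ≠ 0 := by
      rw [← map_natCast (algebraMap K L)]
      exact (map_ne_zero (algebraMap K L)).2 hnK
    have hv0 : v = 0 := by
      have : (n : L) * v = 0 := by
        have h4 : s = s + (n : L) * v := h3
        linear_combination -h4
      exact (mul_eq_zero.1 this).resolve_left hnL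
    refine algEquiv_eq_of_adjoin_eq_top htop ?_ ?_
    · rw [hσs, hv0, add_zero]; rfl
    · rw [hy σ hσ]; rfl
  have hinj : Function.Injective χ := by
    rw [injective_iff_map_eq_one]
    rintro ⟨σ, hσ⟩ h
    exact Subtype.ext (hker σ hσ h)
  have : IsCyclic G := isCyclic_of_injective_ringHom χ hinj
  obtain ⟨⟨σ, hσ⟩, hgen⟩ := IsCyclic.exists_generator (α := G)
  have hord : orderOf (⟨σ, hσ⟩ : G) = n := by
    rw [← hn, orderOf_eq_card_of_forall_mem_zpowers hgen]
  have hprim : IsPrimitiveRoot (a σ) n := by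
    have h1 : orderOf (χ ⟨σ, hσ⟩) = n := by rw [orderOf_injective χ hinj, hord]
    rw [← h1]
    exact IsPrimitiveRoot.orderOf _
  have hGz : G = Subgroup.zpowers σ := by
    apply le_antisymm
    · intro τ hτ
      obtain ⟨k, hk⟩ := Subgroup.mem_zpowers_iff.1 (hgen ⟨τ, hτ⟩)
      refine Subgroup.mem_zpowers_iff.2 ⟨k, ?_⟩
      simpa using congrArg Subtype.val hk
    · exact Subgroup.zpowers_le.2 hσ
  have hne : a σ - 1 ≠ 0 := by
    intro h
    apply hG
    rw [hGz, hker σ hσ (sub_eq_zero.1 h), Subgroup.zpowers_one_eq_bot]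
  -- The shear coefficient β must satisfy b + β = a β, that is β = b / (a - 1); likewise for the
  -- constant term.
  refine ⟨σ, a σ, b σ / (a σ - 1), c σ / (a σ - 1), hGz, hprim, ?_⟩
  have hne' : algebraMap K L (a σ) - 1 ≠ 0 := by
    rw [← map_one (algebraMap K L), ← map_sub]
    exact (map_ne_zero (algebraMap K L)).2 hne
  simp only [map_add, map_smul, hy σ hσ, AlgEquiv.commutes, habc σ hσ]
  simp only [Algebra.smul_def, map_div₀, map_sub, map_one]
  field_simp
  ring

/-- Over M = K(x^n, y) the field is M[x], and σ multiplies x^i by ξ^i. Averaging a fixed element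
over the powers of σ therefore leaves only exponents divisible by n, and n is invertible. -/
theorem mem_adjoin_pow_of_fixed {K L : Type*} [Field K] [Field L] [Algebra K L] {x y : L}
    (htop : IntermediateField.adjoin K {x, y} = ⊤) {n : ℕ} (hnK : (n : K) ≠ 0) {ξ : K}
    (hξ : IsPrimitiveRoot ξ n) {σ : L ≃ₐ[K] L} (hx : σ x = ξ • x) (hy : σ y = y) {g : L}
    (hg : σ g = g) : g ∈ IntermediateField.adjoin K (Set.range ![x ^ n, y]) := by
  set M := IntermediateField.adjoin K (Set.range ![x ^ n, y]) with hM
  have hn0 : n ≠ 0 := by rintro rfl; simp at hnK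
  have hxM : x ^ n ∈ M := IntermediateField.subset_adjoin K _ ⟨0, rfl⟩
  have hyM : y ∈ M := IntermediateField.subset_adjoin K _ ⟨1, rfl⟩
  have hσx : σ (x ^ n) = x ^ n := by
    rw [map_pow, hx, smul_pow, hξ.pow_eq_one, one_smul]
  have hpowx : ∀ k : ℕ, (σ ^ k) x = ξ ^ k • x := by
    intro k
    induction k with
    | zero => simp
    | succ k ih =>
      rw [pow_succ']
      change σ ((σ ^ k) x) = _
      rw [ih, map_smul, hx, smul_smul, pow_succ]
  have hfixM : ∀ m ∈ M, ∀ k : ℕ, (σ ^ k) m = m := by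
    have hle : M ≤ IntermediateField.fixedField (Subgroup.zpowers σ) := by
      rw [hM, IntermediateField.adjoin_le_iff]
      have : ∀ z : L, σ z = z → z ∈ IntermediateField.fixedField (Subgroup.zpowers σ) := by
        intro z hz
        rw [IntermediateField.mem_fixedField_iff]
        intro f hf
        have h1 : σ ∈ MulAction.stabilizer (L ≃ₐ[K] L) z := hz
        exact (Subgroup.zpowers_le.2 h1) hf
      rintro z ⟨i, rfl⟩
      fin_cases i
      · exact this _ hσx
      · exact this _ hy
    intro m hm k
    exact (IntermediateField.mem_fixedField_iff _ _).1 (hle hm) _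
      (Subgroup.npow_mem_zpowers _ _)
  have hint : IsIntegral M x :=
    IsIntegral.of_pow (Nat.pos_of_ne_zero hn0)
      (by simpa using (isIntegral_algebraMap (R := M) (A := L) (x := ⟨x ^ n, hxM⟩)))
  have htop' : IntermediateField.adjoin M {x} = ⊤ := by
    have h1 : IntermediateField.adjoin K {x, y} ≤
        (IntermediateField.adjoin M {x}).restrictScalars K := by
      rw [IntermediateField.adjoin_le_iff]
      rintro z (rfl | rfl)
      · exact IntermediateField.mem_adjoin_simple_self M _
      · exact (IntermediateField.adjoin M {x}).algebraMap_mem ⟨_, hyM⟩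
    rw [eq_top_iff]
    intro z _
    exact h1 (htop ▸ IntermediateField.mem_top)
  have hgx : g ∈ Algebra.adjoin M {x} := by
    rw [← IntermediateField.adjoin_simple_toSubalgebra_of_isAlgebraic hint.isAlgebraic, htop']
    trivial
  obtain ⟨P, rfl⟩ := (Algebra.adjoin_singleton_eq_range_aeval M x ▸ hgx :)
  set g := Polynomial.aeval x P with hgdef
  have hgσ : ∀ k : ℕ, (σ ^ k) g = g := by
    intro k
    induction k with
    | zero => rfl
    | succ k ih =>
      rw [pow_succ']
      change σ ((σ ^ k) g) = _
      rw [ih]; exact hg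
  have hexp : ∀ k : ℕ, (σ ^ k) g =
      ∑ i ∈ P.support, (P.coeff i : L) * ((algebraMap K L ξ ^ i) ^ k * x ^ i) := by
    intro k
    rw [hgdef, Polynomial.aeval_eq_sum_range, ← Polynomial.sum_over_range' P (f := fun i m => m • x ^ i) (by simp) _ (Nat.lt_succ_self _), Polynomial.sum, map_sum]
    refine Finset.sum_congr rfl fun i _ => ?_
    rw [Algebra.smul_def, map_mul, map_pow, hpowx]
    change (σ ^ k) ((P.coeff i : M) : L) * _ = _
    rw [hfixM _ (P.coeff i).2 k, Algebra.smul_def, mul_pow, map_pow]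
    ring
  have hsum : (n : L) * g =
      ∑ i ∈ P.support, (P.coeff i : L) *
        ((∑ k ∈ Finset.range n, (algebraMap K L ξ ^ i) ^ k) * x ^ i) := by
    calc (n : L) * g = ∑ k ∈ Finset.range n, (σ ^ k) g := by simp [hgσ]
      _ = _ := by
        simp_rw [hexp]
        rw [Finset.sum_comm]
        refine Finset.sum_congr rfl fun i _ => ?_
        rw [Finset.sum_mul, Finset.mul_sum]
  have hmem : (n : L) * g ∈ M := by
    rw [hsum]
    refine sum_mem fun i _ => mul_mem (P.coeff i).2 ?_
    have hξL : IsPrimitiveRoot (algebraMap K L ξ) n :=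
      hξ.map_of_injective (algebraMap K L).injective
    -- The geometric sum of the powers of ξ^i is n if n ∣ i and 0 otherwise.
    by_cases hi : n ∣ i
    · obtain ⟨j, rfl⟩ := hi
      refine mul_mem ?_ (by rw [pow_mul]; exact pow_mem hxM j)
      simp [pow_mul, hξL.pow_eq_one, natCast_mem]
    · have h1 : algebraMap K L ξ ^ i ≠ 1 := fun h => hi (hξL.dvd_of_pow_eq_one i h)
      have h2 : (∑ k ∈ Finset.range n, (algebraMap K L ξ ^ i) ^ k) = 0 := by
        have := geom_sum_mul (algebraMap K L ξ ^ i) n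
        rw [← pow_mul, mul_comm i n, pow_mul, hξL.pow_eq_one, one_pow, sub_self] at this
        exact (mul_eq_zero.1 this).resolve_right (sub_ne_zero.2 h1)
      rw [h2, zero_mul]
      exact zero_mem M
  have hnL : (n : L) ≠ 0 := by
    rw [← map_natCast (algebraMap K L)]
    exact (map_ne_zero (algebraMap K L)).2 hnK
  have := div_mem hmem (natCast_mem M n)
  rwa [mul_div_cancel_left₀ _ hnL] at this

/-! ### Homogeneity, and derivations as homomorphisms to dual numbers -/

theorem aeval_mul_of_isHomogeneous {K E ι : Type*} [Field K] [Field E] [Algebra K E]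
    {F : MvPolynomial ι K} {d : ℕ} (hF : F.IsHomogeneous d) (c : E) (v : ι → E) :
    aeval (fun i => c * v i) F = c ^ d * aeval v F := by
  rw [aeval_def, aeval_def, eval₂_eq, eval₂_eq, Finset.mul_sum]
  refine Finset.sum_congr rfl fun m hm => ?_
  have hdeg : ∑ i ∈ m.support, m i = d := by
    simpa [Finsupp.weight_apply, Finsupp.sum] using hF (mem_support_iff.1 hm)
  simp_rw [mul_pow, Finset.prod_mul_distrib, Finset.prod_pow_eq_pow_sum]
  rw [hdeg]
  ring

/-- First-order Taylor expansion, exact because ε² = 0. It lets a derivation D be handled as the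
algebra homomorphism e ↦ e + ε D(e). -/
theorem aeval_dualNumber {K E ι : Type*} [Field K] [CommRing E] [Algebra K E] [Fintype ι]
    (a b : ι → E) (P : MvPolynomial ι K) :
    aeval (fun i => (TrivSqZeroExt.inl (a i) + TrivSqZeroExt.inr (b i) : DualNumber E)) P =
      TrivSqZeroExt.inl (aeval a P) +
        TrivSqZeroExt.inr (∑ i, aeval a (pderiv i P) * b i) := by
  induction P using MvPolynomial.induction_on with
  | C c =>
    simp only [algHom_C, pderiv_C, map_zero, zero_mul, Finset.sum_const_zero,
      TrivSqZeroExt.inr_zero, add_zero]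
    rfl
  | add p q hp hq =>
    rw [map_add, hp, hq]
    ext <;> simp [add_mul, Finset.sum_add_distrib]
  | mul_X p j hp =>
    classical
    rw [map_mul, hp, aeval_X]
    ext
    · simp
    · simp only [map_add, map_mul, Derivation.leibniz, pderiv_X, smul_eq_mul, aeval_X,
        TrivSqZeroExt.snd_mul, TrivSqZeroExt.snd_add, TrivSqZeroExt.fst_add,
        TrivSqZeroExt.snd_inl, TrivSqZeroExt.snd_inr, TrivSqZeroExt.fst_inl,
        TrivSqZeroExt.fst_inr, add_zero, zero_add, add_mul, Finset.sum_add_distrib,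
        MulOpposite.smul_eq_mul_unop, MulOpposite.unop_op]
      have h1 : ∑ x, aeval a p * aeval a ((Pi.single x 1 : ι → MvPolynomial ι K) j) * b x =
          aeval a p * b j := by
        rw [Finset.sum_eq_single j (by
          intro i _ hi
          rw [Pi.single_eq_of_ne' hi, map_zero, mul_zero, zero_mul]) (by simp),
          Pi.single_eq_same, map_one, mul_one]
      rw [h1, zero_mul, zero_mul, add_zero, zero_add, Finset.sum_mul]
      congr 1
      exact Finset.sum_congr rfl fun i _ => by ring

/-- If the derivation `∑ uᵢ ∂ᵢ` preserves the ideal of relations, it extends to the field of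
fractions of the coordinate ring. -/
theorem exists_dualNumber_lift {K R E ι : Type*} [Field K] [CommRing R] [IsDomain R] [Field E]
    [Algebra K R] [Algebra R E] [Algebra K E] [IsScalarTower K R E] [IsFractionRing R E]
    [Fintype ι] (π : MvPolynomial ι K →ₐ[K] R) (hπ : Function.Surjective π) (u : ι → K)
    (hu : ∀ P, π P = 0 → ∑ i, π (pderiv i P) * algebraMap K R (u i) = 0) :
    ∃ φ : E →ₐ[K] DualNumber E, (∀ e, (φ e).fst = e) ∧
      ∀ i, φ (algebraMap R E (π (X i))) = TrivSqZeroExt.inl (algebraMap R E (π (X i))) +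
        TrivSqZeroExt.inr (algebraMap K E (u i)) := by
  let x : ι → E := fun i => algebraMap R E (π (X i))
  have hx : ∀ P, aeval x P = algebraMap R E (π P) := by
    intro P
    have h : (aeval x : MvPolynomial ι K →ₐ[K] E) = (IsScalarTower.toAlgHom K R E).comp π := by
      ext i
      rw [aeval_X]
      rfl
    rw [h]
    rfl
  let ψ : MvPolynomial ι K →ₐ[K] DualNumber E :=
    aeval (fun i => TrivSqZeroExt.inl (x i) + TrivSqZeroExt.inr (algebraMap K E (u i)))
  have hψ : ∀ P, ψ P = TrivSqZeroExt.inl (aeval x P) +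
      TrivSqZeroExt.inr (∑ i, aeval x (pderiv i P) * algebraMap K E (u i)) :=
    aeval_dualNumber x (fun i => algebraMap K E (u i))
  have hker : ∀ P, π P = 0 → ψ P = 0 := by
    intro P hP
    have h := congrArg (algebraMap R E) (hu P hP)
    simp only [map_sum, map_mul, map_zero, ← hx, ← IsScalarTower.algebraMap_apply] at h
    rw [hψ, hx, hP, h]
    simp
  let φ₀ : R →ₐ[K] DualNumber E :=
    (Ideal.Quotient.liftₐ (RingHom.ker π) ψ hker).comp
      (Ideal.quotientKerAlgEquivOfSurjective hπ).symm.toAlgHom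
  have hφ₀ψ : ∀ P, φ₀ (π P) = ψ P := by
    intro P
    have : (Ideal.quotientKerAlgEquivOfSurjective hπ).symm (π P) = Ideal.Quotient.mk _ P := by
      rw [AlgEquiv.symm_apply_eq]
      rfl
    change Ideal.Quotient.liftₐ (RingHom.ker π) ψ hker
      ((Ideal.quotientKerAlgEquivOfSurjective hπ).symm (π P)) = _
    rw [this]
    rfl
  have hφ₀ : ∀ a : R, (φ₀ a).fst = algebraMap R E a := by
    intro a
    obtain ⟨P, rfl⟩ := hπ a
    rw [hφ₀ψ, hψ, hx]
    simp
  -- A dual number is a unit as soon as its first component is, so all denominators can be inverted.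
  have hunit : ∀ a : nonZeroDivisors R, IsUnit (φ₀ a) := by
    intro a
    rw [TrivSqZeroExt.isUnit_iff_isUnit_fst, hφ₀, isUnit_iff_ne_zero]
    exact IsFractionRing.to_map_ne_zero_of_mem_nonZeroDivisors a.2
  let φ : E →ₐ[K] DualNumber E := IsLocalization.liftAlgHom hunit
  have hφ : ∀ a : R, φ (algebraMap R E a) = φ₀ a := fun a => IsLocalization.lift_eq hunit a
  refine ⟨φ, ?_, ?_⟩
  · intro e
    obtain ⟨a, b, hb, rfl⟩ := IsFractionRing.div_surjective (A := R) e
    have hb' : algebraMap R E b ≠ 0 := IsFractionRing.to_map_ne_zero_of_mem_nonZeroDivisors hb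
    rw [eq_div_iff hb']
    have h1 : φ (algebraMap R E a / algebraMap R E b) * φ (algebraMap R E b) =
        φ (algebraMap R E a) := by
      rw [← map_mul, div_mul_cancel₀ _ hb']
    have h2 := congrArg TrivSqZeroExt.fst h1
    rwa [TrivSqZeroExt.fst_mul, hφ b, hφ a, hφ₀, hφ₀] at h2
  · intro i
    rw [hφ, hφ₀ψ]
    simp only [ψ, aeval_X]
    rfl

/-! ### The coordinate field and the affine equation of the curve -/

namespace PlaneCurve

variable {k K : Type*} [Field k] [Field K] [Algebra k K] (C : PlaneCurve k K)

theorem cls_eq_aeval (P : MvPolynomial (Fin 3) K) : C.cls P = aeval C.coord P := by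
  have h : (aeval C.coord : MvPolynomial (Fin 3) K →ₐ[K] C.CoordField) =
      (IsScalarTower.toAlgHom K C.CoordRing C.CoordField).comp (Ideal.Quotient.mkₐ K _) := by
    ext i
    rw [aeval_X]
    rfl
  rw [h]
  rfl

theorem aeval_coord_eq_zero_iff (P : MvPolynomial (Fin 3) K) :
    aeval C.coord P = 0 ↔ C.polyK ∣ P := by
  rw [← cls_eq_aeval, cls, map_eq_zero_iff _ (IsFractionRing.injective C.CoordRing C.CoordField),
    Ideal.Quotient.eq_zero_iff_mem, Ideal.mem_span_singleton]

theorem polyK_isHomogeneous : C.polyK.IsHomogeneous C.degree := C.homogeneous.map _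

/-- Euler's identity: its right-hand side is a multiple of F, hence zero on the curve, whatever the
degree is modulo p. -/
theorem sum_coord_mul_gaussMap : ∑ i, C.coord i * C.gaussMap i = 0 := by
  have h := congrArg (aeval C.coord) C.polyK_isHomogeneous.sum_X_mul_pderiv
  rw [map_sum, nsmul_eq_mul, map_mul, (C.aeval_coord_eq_zero_iff _).2 dvd_rfl, mul_zero] at h
  rw [← h]
  refine Finset.sum_congr rfl fun i _ => ?_
  rw [map_mul, aeval_X, gaussMap, cls_eq_aeval]

/-- The point `T (x, y, 1)`, as a triple of polynomials. -/
def affinePoint (T : Matrix (Fin 3) (Fin 3) K) : Fin 3 → MvPolynomial (Fin 2) K :=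
  fun i => ∑ j, MvPolynomial.C (T i j) *
    (![X 0, X 1, 1] : Fin 3 → MvPolynomial (Fin 2) K) j

theorem affinePoly_eq (T : GL (Fin 3) K) :
    C.affinePoly T = aeval (affinePoint (T : Matrix (Fin 3) (Fin 3) K)) C.polyK := rfl

theorem aeval_polyK_eq {E : Type*} [Field E] [Algebra K E] (T : GL (Fin 3) K) (s : Fin 3 → E)
    (hs : s 2 ≠ 0) :
    aeval ((T : Matrix (Fin 3) (Fin 3) K).map (algebraMap K E) |>.mulVec s) C.polyK =
      s 2 ^ C.degree * aeval ![s 0 / s 2, s 1 / s 2] (C.affinePoly T) := by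
  have h : aeval ![s 0 / s 2, s 1 / s 2] (C.affinePoly T) =
      aeval (fun i => aeval ![s 0 / s 2, s 1 / s 2]
        (affinePoint (T : Matrix (Fin 3) (Fin 3) K) i)) C.polyK := by
    rw [affinePoly_eq, ← AlgHom.comp_apply, comp_aeval]
  rw [h, ← aeval_mul_of_isHomogeneous C.polyK_isHomogeneous]
  congr 2
  ext i
  simp only [affinePoint, Matrix.mulVec, dotProduct, Fin.sum_univ_three, Matrix.map_apply]
  simp
  field_simp

/-- If the affine equation vanished, F would be zero off the line ℓ = 0, so ℓ F would vanish at
every point; K being infinite, ℓ F = 0. -/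
theorem affinePoly_ne_zero [Infinite K] (T : GL (Fin 3) K) : C.affinePoly T ≠ 0 := by
  intro h0
  set S : Matrix (Fin 3) (Fin 3) K := ((T⁻¹ : GL (Fin 3) K) : Matrix (Fin 3) (Fin 3) K) with hS
  have hTS : (T : Matrix (Fin 3) (Fin 3) K) * S = 1 := by
    rw [hS, ← Units.val_mul, mul_inv_cancel, Units.val_one]
  have hST : S * (T : Matrix (Fin 3) (Fin 3) K) = 1 := by
    rw [hS, ← Units.val_mul, inv_mul_cancel, Units.val_one]
  let ℓ : MvPolynomial (Fin 3) K := ∑ j, MvPolynomial.C (S 2 j) * X j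
  have hℓ : ∀ v : Fin 3 → K, eval v ℓ = (S.mulVec v) 2 := by
    intro v
    simp [ℓ, Matrix.mulVec, dotProduct]
  have hprod : ℓ * C.polyK = 0 := by
    apply MvPolynomial.funext
    intro v
    rw [map_mul, map_zero, hℓ]
    by_cases hv : S.mulVec v 2 = 0
    · rw [hv, zero_mul]
    · have h1 := C.aeval_polyK_eq T (S.mulVec v) hv
      rw [h0, map_zero, mul_zero] at h1
      have h2 : ((T : Matrix (Fin 3) (Fin 3) K).map (algebraMap K K)).mulVec (S.mulVec v) = v := by
        change (T : Matrix (Fin 3) (Fin 3) K).mulVec (S.mulVec v) = v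
        rw [Matrix.mulVec_mulVec, hTS, Matrix.one_mulVec]
      rw [h2] at h1
      rw [show eval v C.polyK = 0 from h1, mul_zero]
  rcases mul_eq_zero.1 hprod with h | h
  · have h1 := hℓ ((T : Matrix (Fin 3) (Fin 3) K).mulVec (Pi.single 2 1))
    rw [h, map_zero, Matrix.mulVec_mulVec, hST, Matrix.one_mulVec] at h1
    simp at h1
  · exact C.irreducible.ne_zero h

/-- `G` need not be homogeneous; only its dehomogenisation and its value at `t` matter. Powers of X₂
bring the two terms of a sum to the same exponent. -/
theorem exists_homogenization {E : Type*} [Field E] [Algebra K E] (t : Fin 3 → E) (ht : t 2 ≠ 0)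
    (g : MvPolynomial (Fin 2) K) :
    ∃ (N : ℕ) (G : MvPolynomial (Fin 3) K),
      aeval (![X 0, X 1, 1] : Fin 3 → MvPolynomial (Fin 2) K) G = g ∧
      aeval t G = t 2 ^ N * aeval ![t 0 / t 2, t 1 / t 2] g := by
  induction g using MvPolynomial.induction_on with
  | C c => exact ⟨0, MvPolynomial.C c, by simp, by simp⟩
  | add p q hp hq =>
    obtain ⟨N₁, G₁, h₁, h₁'⟩ := hp
    obtain ⟨N₂, G₂, h₂, h₂'⟩ := hq
    refine ⟨N₁ + N₂, X 2 ^ N₂ * G₁ + X 2 ^ N₁ * G₂, by rw [map_add, map_mul, map_mul, h₁, h₂]; simp, ?_⟩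
    simp only [map_add, map_mul, map_pow, aeval_X, h₁', h₂']
    ring
  | mul_X p j hp =>
    obtain ⟨N, G, h, h'⟩ := hp
    refine ⟨N + 1, G * X (Fin.castSucc j), ?_, ?_⟩
    · rw [map_mul, h, aeval_X]
      fin_cases j <;> rfl
    · rw [map_mul, map_mul, h', aeval_X, aeval_X]
      fin_cases j <;> simp <;> field_simp <;> ring

/-- The affine polynomial generates the ideal of relations between the affine coordinates. -/
theorem aeval_eq_zero_iff_affinePoly_dvd (T : GL (Fin 3) K) {t : Fin 3 → C.CoordField}
    (htT : ((T : Matrix (Fin 3) (Fin 3) K).map (algebraMap K C.CoordField)).mulVec t = C.coord)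
    (ht : t 2 ≠ 0) (g : MvPolynomial (Fin 2) K) :
    aeval ![t 0 / t 2, t 1 / t 2] g = 0 ↔ C.affinePoly T ∣ g := by
  constructor
  · intro h
    obtain ⟨N, G, h₁, h₂⟩ := exists_homogenization t ht g
    rw [h, mul_zero] at h₂
    set S : Matrix (Fin 3) (Fin 3) K := ((T⁻¹ : GL (Fin 3) K) : Matrix (Fin 3) (Fin 3) K) with hS
    have hST : S * (T : Matrix (Fin 3) (Fin 3) K) = 1 := by
      rw [hS, ← Units.val_mul, inv_mul_cancel, Units.val_one]
    have hcoord : (S.map (algebraMap K C.CoordField)).mulVec C.coord = t := by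
      rw [← htT, Matrix.mulVec_mulVec, ← Matrix.map_mul, hST]
      simp
    -- `G'` is `G` in the original coordinates. It vanishes at the generic point, so F divides it;
    -- dehomogenising this divisibility along `T` gives the claim.
    let G' : MvPolynomial (Fin 3) K := aeval (fun i => ∑ j, MvPolynomial.C (S i j) * X j) G
    have hG' : aeval C.coord G' = 0 := by
      rw [← h₂]
      simp only [G']
      rw [← AlgHom.comp_apply, comp_aeval]
      congr 2
      ext i
      rw [← hcoord]
      simp [Matrix.mulVec, dotProduct]
    rw [aeval_coord_eq_zero_iff] at hG'
    have h3 := map_dvd (aeval (affinePoint (T : Matrix (Fin 3) (Fin 3) K))) hG'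
    rw [← affinePoly_eq] at h3
    convert h3 using 1
    rw [← h₁]
    simp only [G']
    rw [← AlgHom.comp_apply, comp_aeval]
    congr 2
    ext1 i
    have hTSi : ∀ l, ∑ j, S i j * (T : Matrix (Fin 3) (Fin 3) K) j l =
        (1 : Matrix (Fin 3) (Fin 3) K) i l := by
      intro l
      rw [← hST, Matrix.mul_apply]
    have h4 : aeval (affinePoint (T : Matrix (Fin 3) (Fin 3) K))
        (∑ j, MvPolynomial.C (S i j) * X j : MvPolynomial (Fin 3) K) =
        ∑ l, MvPolynomial.C ((1 : Matrix (Fin 3) (Fin 3) K) i l) *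
          (![X 0, X 1, 1] : Fin 3 → MvPolynomial (Fin 2) K) l := by
      simp only [map_sum, map_mul, aeval_X, algHom_C, affinePoint, Finset.mul_sum, ← hTSi,
        Finset.sum_mul, algebraMap_eq]
      rw [Finset.sum_comm]
      exact Finset.sum_congr rfl fun _ _ => Finset.sum_congr rfl fun _ _ => by ring
    rw [h4, Finset.sum_eq_single i (by
      intro l _ hl
      rw [Matrix.one_apply_ne' hl, map_zero, zero_mul]) (by simp), Matrix.one_apply_eq, map_one,
      one_mul]
  · rintro ⟨h, rfl⟩
    have h1 := C.aeval_polyK_eq T t ht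
    rw [htT, (C.aeval_coord_eq_zero_iff _).2 dvd_rfl] at h1
    rw [map_mul, (mul_eq_zero.1 h1.symm).resolve_left (pow_ne_zero _ ht), zero_mul]

/-- The affine equation generates the kernel of evaluation at the generic point, with values in a
field, so it is prime. -/
theorem affinePoly_irreducible [Infinite K] (T : GL (Fin 3) K) {t : Fin 3 → C.CoordField}
    (htT : ((T : Matrix (Fin 3) (Fin 3) K).map (algebraMap K C.CoordField)).mulVec t = C.coord)
    (ht : t 2 ≠ 0) : Irreducible (C.affinePoly T) := by
  refine Prime.irreducible ⟨C.affinePoly_ne_zero T, ?_, ?_⟩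
  · intro hu
    have := (C.aeval_eq_zero_iff_affinePoly_dvd T htT ht 1).2 hu.dvd
    simp at this
  · intro a b hab
    simp only [← C.aeval_eq_zero_iff_affinePoly_dvd T htT ht] at hab ⊢
    simpa using hab

/-- The infinitesimal translation in a direction `u` that is tangent everywhere. -/
theorem exists_dualNumber_hom (u : Fin 3 → K)
    (hu : ∑ i, algebraMap K C.CoordField (u i) * C.gaussMap i = 0) :
    ∃ φ : C.CoordField →ₐ[K] DualNumber C.CoordField,
      (∀ e, (φ e).fst = e) ∧
      ∀ i, φ (C.coord i) = TrivSqZeroExt.inl (C.coord i) +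
        TrivSqZeroExt.inr (algebraMap K C.CoordField (u i)) := by
  have hu' : ∀ P, Ideal.Quotient.mkₐ K (Ideal.span {C.polyK}) P = 0 →
      ∑ i, Ideal.Quotient.mkₐ K (Ideal.span {C.polyK}) (pderiv i P) *
        algebraMap K C.CoordRing (u i) = 0 := by
    intro P hP
    apply IsFractionRing.injective C.CoordRing C.CoordField
    obtain ⟨Q, rfl⟩ := Ideal.mem_span_singleton.1 (Ideal.Quotient.eq_zero_iff_mem.1 hP)
    have h0 : C.cls C.polyK = 0 := by
      rw [cls_eq_aeval, aeval_coord_eq_zero_iff]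
    -- By Leibniz, ∂(FQ) = Q ∂F modulo F, and ∂F along `u` is zero by hypothesis: the ideal (F) is
    -- preserved.
    have h1 : ∀ i, C.cls (pderiv i (C.polyK * Q)) = C.cls Q * C.gaussMap i := by
      intro i
      rw [gaussMap]
      simp only [cls_eq_aeval] at h0 ⊢
      rw [Derivation.leibniz, map_add, smul_eq_mul, smul_eq_mul, map_mul, map_mul, h0]
      ring
    rw [map_sum, map_zero]
    calc _ = C.cls Q * ∑ i, algebraMap K C.CoordField (u i) * C.gaussMap i := by
          rw [Finset.mul_sum]
          refine Finset.sum_congr rfl fun i _ => ?_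
          rw [map_mul, ← IsScalarTower.algebraMap_apply]
          change C.cls (pderiv i (C.polyK * Q)) * _ = _
          rw [h1]
          ring
      _ = 0 := by rw [hu, mul_zero]
  exact exists_dualNumber_lift (E := C.CoordField) (Ideal.Quotient.mkₐ K (Ideal.span {C.polyK}))
    (Ideal.Quotient.mkₐ_surjective K _) u hu'

end PlaneCurve

/-! ### Rigidity of vectors over the constants -/

/-- The eigenvalue `h` is a root of the characteristic polynomial of `B`, which has coefficients in
K, so it is a constant c. The rows of B - c are then K-linear relations between the coordinates of
`x`. -/
theorem exists_eq_scalar_of_mulVec_eq_smul {K E : Type*} [Field K] [IsAlgClosed K] [Field E]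
    [Algebra K E] {x : Fin 3 → E}
    (hx : ∀ a : Fin 3 → K, ∑ i, algebraMap K E (a i) * x i = 0 → a = 0)
    {B : Matrix (Fin 3) (Fin 3) K} {h : E}
    (hB : (B.map (algebraMap K E)).mulVec x = h • x) :
    ∃ c : K, B = Matrix.scalar (Fin 3) c := by
  have hx0 : x ≠ 0 := by
    rintro rfl
    have := congrFun (hx 1 (by simp)) 0
    simp at this
  have hdet : (Matrix.scalar (Fin 3) h - B.map (algebraMap K E)).det = 0 := by
    rw [← Matrix.exists_mulVec_eq_zero_iff]
    refine ⟨x, hx0, ?_⟩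
    rw [Matrix.sub_mulVec, hB]
    simp
  rw [← Matrix.eval_charpoly, Matrix.charpoly_map, Polynomial.eval_map_algebraMap] at hdet
  obtain ⟨c, rfl⟩ := exists_algebraMap_eq_of_aeval_eq_zero B.charpoly_monic.ne_zero hdet
  refine ⟨c, ?_⟩
  ext i j
  have h1 := hx (fun l => B i l - Matrix.scalar (Fin 3) c i l) (by
    have := congrFun hB i
    simp only [Matrix.mulVec, dotProduct, Matrix.map_apply, Pi.smul_apply, smul_eq_mul] at this
    simp only [map_sub, sub_mul, Finset.sum_sub_distrib, this]
    rw [Finset.sum_eq_single i (by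
      intro l _ hl
      rw [Matrix.scalar_apply, Matrix.diagonal_apply_ne' _ hl, map_zero, zero_mul]) (by simp),
      Matrix.scalar_apply, Matrix.diagonal_apply_eq, sub_self])
  exact sub_eq_zero.1 (congrFun h1 j)

/-- Otherwise the cross product of `u` and `u'` is a nonzero constant vector to which `g` is
parallel. This makes a point common to all tangent lines unique. -/
theorem proportional_of_orthogonal {K E : Type*} [Field K] [Field E] [Algebra K E]
    {g : Fin 3 → E} (hg : ∀ (c : E) (v : Fin 3 → K), ¬ ∀ i, g i = c * algebraMap K E (v i))
    {u u' : Fin 3 → K} (hu0 : u ≠ 0) (hu : ∑ i, algebraMap K E (u i) * g i = 0)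
    (hu' : ∑ i, algebraMap K E (u' i) * g i = 0) : ∃ κ : K, ∀ i, u' i = κ * u i := by
  have hcross : ∀ i j, u i * u' j = u j * u' i := by
    by_contra hne
    let v : Fin 3 → K := ![u 1 * u' 2 - u 2 * u' 1, u 2 * u' 0 - u 0 * u' 2,
      u 0 * u' 1 - u 1 * u' 0]
    have hv : ∃ j, v j ≠ 0 := by
      by_contra hv
      push Not at hv
      have h0 := hv 0
      have h1 := hv 1
      have h2 := hv 2
      simp only [v, Matrix.cons_val] at h0 h1 h2
      apply hne
      intro i j
      fin_cases i <;> fin_cases j <;> simp <;> first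
        | ring1
        | linear_combination h0
        | linear_combination -h0
        | linear_combination h1
        | linear_combination -h1
        | linear_combination h2
        | linear_combination -h2
    obtain ⟨j, hj⟩ := hv
    rw [Fin.sum_univ_three] at hu hu'
    have hpar : ∀ i, g i * algebraMap K E (v j) = g j * algebraMap K E (v i) := by
      have h01 : g 0 * algebraMap K E (v 1) = g 1 * algebraMap K E (v 0) := by
        simp only [v, Matrix.cons_val, map_sub, map_mul]
        linear_combination algebraMap K E (u 2) * hu' - algebraMap K E (u' 2) * hu
      have h12 : g 1 * algebraMap K E (v 2) = g 2 * algebraMap K E (v 1) := by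
        simp only [v, Matrix.cons_val, map_sub, map_mul]
        linear_combination algebraMap K E (u 0) * hu' - algebraMap K E (u' 0) * hu
      have h20 : g 2 * algebraMap K E (v 0) = g 0 * algebraMap K E (v 2) := by
        simp only [v, Matrix.cons_val, map_sub, map_mul]
        linear_combination algebraMap K E (u 1) * hu' - algebraMap K E (u' 1) * hu
      intro i
      fin_cases i <;> fin_cases j <;> first | rfl | assumption | (symm; assumption)
    apply hg (g j / algebraMap K E (v j)) v
    intro i
    have hj' : algebraMap K E (v j) ≠ 0 := (map_ne_zero _).2 hj
    rw [div_mul_eq_mul_div, eq_div_iff hj', hpar]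
  obtain ⟨j, hj⟩ := Function.ne_iff.1 hu0
  refine ⟨u' j / u j, fun i => ?_⟩
  have hj' : u j ≠ 0 := hj
  field_simp
  linear_combination -hcross i j

/-! ### Linear automorphisms and nonconstancy of the Gauss map -/

namespace PlaneCurve

variable {k K : Type*} [Field k] [Field K] [Algebra k K] (C : PlaneCurve k K)

/-- The image of the generic point of the curve under the matrix `M`. -/
def linMap (M : Matrix (Fin 3) (Fin 3) K) : Fin 3 → C.CoordField :=
  (M.map (algebraMap K C.CoordField)).mulVec C.coord

theorem coe_linRatio (M : Matrix (Fin 3) (Fin 3) K) (i j : Fin 3) :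
    (C.linRatio M i j : C.CoordField) = C.linMap M i / C.linMap M j := rfl

theorem linMap_one : C.linMap 1 = C.coord := by
  simp [linMap]

theorem linMap_mul (M N : Matrix (Fin 3) (Fin 3) K) :
    C.linMap (M * N) = (M.map (algebraMap K C.CoordField)).mulVec (C.linMap N) := by
  rw [linMap, linMap, Matrix.mulVec_mulVec, Matrix.map_mul]

theorem linMap_mul_apply (M N : Matrix (Fin 3) (Fin 3) K) (i : Fin 3) :
    C.linMap (M * N) i = ∑ l, algebraMap K C.CoordField (M i l) * C.linMap N l := by
  rw [linMap_mul]; rfl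

theorem linMap_apply (M : Matrix (Fin 3) (Fin 3) K) (i : Fin 3) :
    C.linMap M i = ∑ l, algebraMap K C.CoordField (M i l) * C.coord l := rfl

theorem linMap_ne_zero
    (hli : ∀ a : Fin 3 → K, ∑ i, algebraMap K C.CoordField (a i) * C.coord i = 0 → a = 0)
    {M : Matrix (Fin 3) (Fin 3) K} (hM : IsUnit M) (i : Fin 3) : C.linMap M i ≠ 0 := by
  intro h
  have h1 : M i = 0 := hli _ h
  have h2 := Matrix.det_eq_zero_of_row_eq_zero i (fun j => congrFun h1 j)
  rw [Matrix.isUnit_iff_isUnit_det, h2] at hM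
  exact not_isUnit_zero hM

/-- A curve whose Gauss map is not constant is not a line. -/
theorem coord_linearIndependent
    (hg : ∀ (c : C.CoordField) (v : Fin 3 → K),
      ¬ ∀ i, C.gaussMap i = c * algebraMap K C.CoordField (v i))
    (a : Fin 3 → K) (ha : ∑ i, algebraMap K C.CoordField (a i) * C.coord i = 0) : a = 0 := by
  by_contra hne
  let ℓ : MvPolynomial (Fin 3) K := ∑ i, MvPolynomial.C (a i) * X i
  have hℓd : ∀ i, pderiv i ℓ = MvPolynomial.C (a i) := by
    intro i
    simp [ℓ, pderiv_X, Pi.single_apply]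
  have hℓ0 : ℓ ≠ 0 := by
    intro h
    apply hne
    ext i
    have := hℓd i
    rw [h, map_zero] at this
    simpa using this.symm
  -- F divides a nonzero linear form and is not constant, so it equals that form up to a scalar, and
  -- its gradient is constant.
  have hdvd : C.polyK ∣ ℓ := by
    rw [← aeval_coord_eq_zero_iff, ← ha]
    simp [ℓ]
  obtain ⟨h, hh⟩ := hdvd
  have hh0 : h ≠ 0 := by
    rintro rfl
    exact hℓ0 (by rw [hh, mul_zero])
  have hdeg : ℓ.totalDegree ≤ 1 := by
    refine totalDegree_finsetSum_le fun i _ => ?_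
    refine (totalDegree_mul _ _).trans ?_
    simp
  have hF1 : C.polyK.totalDegree ≠ 0 := by
    intro h0
    apply C.irreducible.not_isUnit
    have h1 := totalDegree_eq_zero_iff_eq_C.1 h0
    change IsUnit C.polyK
    rw [h1]
    refine IsUnit.map _ (isUnit_iff_ne_zero.2 fun h2 => ?_)
    rw [h2, map_zero] at h1
    exact C.irreducible.ne_zero h1
  have hF0 : C.polyK ≠ 0 := C.irreducible.ne_zero
  rw [hh, totalDegree_mul_of_isDomain hF0 hh0] at hdeg
  have hhC := totalDegree_eq_zero_iff_eq_C.1 (show h.totalDegree = 0 by omega)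
  set c := coeff 0 h with hc
  have hc0 : c ≠ 0 := by
    intro h2
    rw [h2, map_zero] at hhC
    exact hh0 hhC
  apply hg (algebraMap K C.CoordField c)⁻¹ a
  intro i
  have h3 := congrArg (aeval C.coord) (hℓd i)
  rw [hh, hhC, mul_comm, pderiv_C_mul, map_mul, algHom_C, algHom_C, ← cls_eq_aeval] at h3
  rw [eq_inv_mul_iff_mul_eq₀ ((map_ne_zero _).2 hc0), ← h3]
  rfl

theorem forall_eq_one_of_surjective (h : Function.Surjective (algebraMap K C.functionField))
    (σ : C.functionField ≃ₐ[K] C.functionField) : σ = 1 := by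
  ext1 x
  obtain ⟨c, rfl⟩ := h x
  rw [AlgEquiv.commutes]
  rfl

/-- If γ is constant, the ratios of the z_i are p^r-th roots of constants, hence constants. Then
K(𝒳) is algebraic over K, so it is K and has no nontrivial automorphism. -/
theorem gaussMap_not_constant [IsAlgClosed K] {p r : ℕ} (hp : p ≠ 0)
    {z : Fin 3 → C.functionField} (hz : C.IsSeparableGaussMap p r z)
    {G : Subgroup (C.functionField ≃ₐ[K] C.functionField)} (hG : G ≠ ⊥)
    (e : C.CoordField) (v : Fin 3 → K) :
    ¬ ∀ i, C.gaussMap i = e * algebraMap K C.CoordField (v i) := by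
  intro hv
  obtain ⟨⟨c, hc, hzc⟩, hsep⟩ := hz
  have hconst : ∀ i j, ∃ κ : K, algebraMap K C.functionField κ = z i / z j := by
    intro i j
    have h1 : ∃ κ : K, (z i / z j) ^ p ^ r = algebraMap K C.functionField κ := by
      -- Here all z_i vanish, and their ratios are 0 by the convention for division by zero.
      by_cases he : e = 0
      · refine ⟨0, ?_⟩
        have h2 : (z i : C.CoordField) ^ p ^ r = 0 := by rw [hzc, hv, he]; simp
        have h3 : z i = 0 := Subtype.ext (pow_eq_zero_iff (pow_ne_zero r hp) |>.1 h2)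
        rw [h3, zero_div, zero_pow (pow_ne_zero r hp), map_zero]
      · refine ⟨v i / v j, Subtype.ext ?_⟩
        change ((z i : C.CoordField) / (z j : C.CoordField)) ^ p ^ r =
          algebraMap K C.CoordField (v i / v j)
        rw [div_pow, hzc, hzc, hv, hv, map_div₀, mul_div_mul_left _ _ hc, mul_div_mul_left _ _ he]
    obtain ⟨κ, hκ⟩ := h1
    refine exists_algebraMap_eq_of_aeval_eq_zero
      (P := Polynomial.X ^ p ^ r - Polynomial.C κ)
      (Polynomial.X_pow_sub_C_ne_zero (Nat.pos_of_ne_zero (pow_ne_zero r hp)) κ) ?_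
    simp [hκ]
  have hbot : ratioField K z ≤ ⊥ := by
    rw [ratioField, IntermediateField.adjoin_le_iff]
    rintro _ ⟨i, j, rfl⟩
    exact IntermediateField.mem_bot.2 (hconst i j)
  have hint : Algebra.IsAlgebraic K (ratioField K z) := by
    refine ⟨fun x => ?_⟩
    obtain ⟨κ, hκ⟩ := IntermediateField.mem_bot.1 (hbot x.2)
    have : x = algebraMap K (ratioField K z) κ := Subtype.ext hκ.symm
    rw [this]
    exact isAlgebraic_algebraMap κ
  have halg : Algebra.IsAlgebraic K C.functionField :=
    Algebra.IsAlgebraic.trans K (ratioField K z) C.functionField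
  have hsurj : Function.Surjective (algebraMap K C.functionField) :=
    IsAlgClosed.algebraMap_bijective_of_isIntegral.2
  apply hG
  rw [Subgroup.eq_bot_iff_forall]
  exact fun σ _ => C.forall_eq_one_of_surjective hsurj σ

/-- An automorphism acts on the function field but not on the coordinate field, so linear forms are
first divided by a common one. -/
theorem linRatio_mul (M N : Matrix (Fin 3) (Fin 3) K) (hN : C.linMap N 0 ≠ 0) (i j : Fin 3) :
    C.linRatio (M * N) i j =
      (∑ l, algebraMap K C.functionField (M i l) * C.linRatio N l 0) /
        (∑ l, algebraMap K C.functionField (M j l) * C.linRatio N l 0) := by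
  apply Subtype.ext
  have key : ∀ i, ((∑ l, algebraMap K C.functionField (M i l) * C.linRatio N l 0 :
      C.functionField) : C.CoordField) = C.linMap (M * N) i / C.linMap N 0 := by
    intro i
    rw [linMap_mul_apply, Finset.sum_div, IntermediateField.coe_sum]
    refine Finset.sum_congr rfl fun l _ => ?_
    rw [mul_div_assoc]
    rfl
  rw [IntermediateField.coe_div, key, key, div_div_div_cancel_right₀ hN]
  rfl

section Linear

variable
  (hli : ∀ a : Fin 3 → K, ∑ i, algebraMap K C.CoordField (a i) * C.coord i = 0 → a = 0)
include hli

/-- σ acts by substituting A X for X, so A appears on the right of M. -/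
theorem map_linRatio {σ : C.functionField ≃ₐ[K] C.functionField} {A : Matrix (Fin 3) (Fin 3) K}
    (hA : IsUnit A) (hσ : ∀ i j, σ (C.linRatio 1 i j) = C.linRatio A i j)
    (M : Matrix (Fin 3) (Fin 3) K) (i j : Fin 3) :
    σ (C.linRatio M i j) = C.linRatio (M * A) i j := by
  conv_lhs => rw [← mul_one M]
  rw [C.linRatio_mul M 1 (C.linMap_ne_zero hli isUnit_one 0),
    C.linRatio_mul M A (C.linMap_ne_zero hli hA 0)]
  simp only [map_div₀, map_sum, map_mul, AlgEquiv.commutes, hσ]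

theorem pow_map_linRatio {σ : C.functionField ≃ₐ[K] C.functionField}
    {A : Matrix (Fin 3) (Fin 3) K}
    (hA : IsUnit A) (hσ : ∀ i j, σ (C.linRatio 1 i j) = C.linRatio A i j) (m : ℕ) (i j : Fin 3) :
    (σ ^ m) (C.linRatio 1 i j) = C.linRatio (A ^ m) i j := by
  induction m with
  | zero => simp
  | succ m ih =>
    rw [pow_succ', pow_succ]
    change σ ((σ ^ m) _) = _
    rw [ih, C.map_linRatio hli hA hσ]

theorem exists_scalar_of_linRatio_eq [IsAlgClosed K] {B : Matrix (Fin 3) (Fin 3) K}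
    (hB : IsUnit B)
    (h : ∀ i j, C.linRatio B i j = C.linRatio 1 i j) : ∃ c : K, B = Matrix.scalar (Fin 3) c := by
  refine exists_eq_scalar_of_mulVec_eq_smul hli (h := C.linMap B 0 / C.coord 0) ?_
  ext i
  have h1 := congrArg Subtype.val (h i 0)
  rw [coe_linRatio, coe_linRatio, linMap_one, div_eq_iff (C.linMap_ne_zero hli hB 0)] at h1
  change C.linMap B i = _
  rw [h1, Pi.smul_apply, smul_eq_mul]
  ring

end Linear

/-- The new affine coordinates generate the function field. -/
theorem adjoin_linRatio_eq_top (T : GL (Fin 3) K)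
    (h2 : C.linMap ((T⁻¹ : GL (Fin 3) K) : Matrix (Fin 3) (Fin 3) K) 2 ≠ 0) :
    IntermediateField.adjoin K
      {C.linRatio ((T⁻¹ : GL (Fin 3) K) : Matrix (Fin 3) (Fin 3) K) 0 2,
        C.linRatio ((T⁻¹ : GL (Fin 3) K) : Matrix (Fin 3) (Fin 3) K) 1 2} = ⊤ := by
  set S : Matrix (Fin 3) (Fin 3) K := ((T⁻¹ : GL (Fin 3) K) : Matrix (Fin 3) (Fin 3) K) with hS
  set M := IntermediateField.adjoin K {C.linRatio S 0 2, C.linRatio S 1 2} with hM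
  have hTS : (T : Matrix (Fin 3) (Fin 3) K) * S = 1 := by
    rw [hS, ← Units.val_mul, mul_inv_cancel, Units.val_one]
  have hcoord : ∀ i, C.coord i / C.linMap S 2 =
      ∑ l, algebraMap K C.CoordField ((T : Matrix (Fin 3) (Fin 3) K) i l) *
        (C.linRatio S l 2 : C.CoordField) := by
    intro i
    rw [← linMap_one, ← hTS, linMap_mul_apply, Finset.sum_div]
    refine Finset.sum_congr rfl fun l _ => ?_
    rw [mul_div_assoc]
    rfl
  have hmem : ∀ l, C.linRatio S l 2 ∈ M := by
    intro l
    fin_cases l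
    · exact IntermediateField.subset_adjoin K _ (Or.inl rfl)
    · exact IntermediateField.subset_adjoin K _ (Or.inr rfl)
    · have : C.linRatio S 2 2 = 1 := Subtype.ext (div_self h2)
      change C.linRatio S 2 2 ∈ M
      rw [this]
      exact one_mem M
  have hgen : ∀ i j (h : C.coord i / C.coord j ∈ C.functionField),
      (⟨C.coord i / C.coord j, h⟩ : C.functionField) ∈ M := by
    intro i j h
    have h3 : (⟨C.coord i / C.coord j, h⟩ : C.functionField) =
        (∑ l, algebraMap K C.functionField ((T : Matrix (Fin 3) (Fin 3) K) i l) *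
          C.linRatio S l 2) /
        (∑ l, algebraMap K C.functionField ((T : Matrix (Fin 3) (Fin 3) K) j l) *
          C.linRatio S l 2) := by
      apply Subtype.ext
      rw [IntermediateField.coe_div, IntermediateField.coe_sum, IntermediateField.coe_sum]
      change C.coord i / C.coord j =
        (∑ l, algebraMap K C.CoordField ((T : Matrix (Fin 3) (Fin 3) K) i l) *
        (C.linRatio S l 2 : C.CoordField)) /
        (∑ l, algebraMap K C.CoordField ((T : Matrix (Fin 3) (Fin 3) K) j l) *
        (C.linRatio S l 2 : C.CoordField))
      rw [← hcoord, ← hcoord, div_div_div_cancel_right₀ h2]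
    rw [h3]
    exact div_mem (sum_mem fun l _ => mul_mem (M.algebraMap_mem _) (hmem l))
      (sum_mem fun l _ => mul_mem (M.algebraMap_mem _) (hmem l))
  rw [eq_top_iff]
  rintro ⟨e, he⟩ -
  have := IntermediateField.adjoin_induction (F := K) (E := C.CoordField)
    (s := {f : C.CoordField | ∃ i j : Fin 3, f = C.coord i / C.coord j})
    (p := fun e he => (⟨e, he⟩ : C.functionField) ∈ M)
    (fun x hx => by
      obtain ⟨i, j, rfl⟩ := hx
      exact hgen i j _)
    (fun c => M.algebraMap_mem c)
    (fun x y hx hy h₁ h₂ => add_mem h₁ h₂)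
    (fun x hx h₁ => inv_mem h₁)
    (fun x y hx hy h₁ h₂ => mul_mem h₁ h₂) he
  exact this

theorem eq_one_of_matrix_scalar (h2 : C.coord 2 ≠ 0) {σ : C.functionField ≃ₐ[K] C.functionField}
    {c : K} (hc : c ≠ 0)
    (hσ : ∀ i j, σ (C.linRatio 1 i j) = C.linRatio (Matrix.scalar (Fin 3) c) i j) : σ = 1 := by
  have hlin : ∀ i, C.linMap (Matrix.scalar (Fin 3) c) i =
      algebraMap K C.CoordField c * C.coord i := by
    intro i
    rw [linMap_apply, Finset.sum_eq_single i (by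
      intro l _ hl
      rw [Matrix.scalar_apply, Matrix.diagonal_apply_ne' _ hl, map_zero, zero_mul]) (by simp),
      Matrix.scalar_apply, Matrix.diagonal_apply_eq]
  have hfix : ∀ i j, σ (C.linRatio 1 i j) = C.linRatio 1 i j := by
    intro i j
    rw [hσ]
    apply Subtype.ext
    rw [coe_linRatio, coe_linRatio, hlin, hlin, linMap_one,
      mul_div_mul_left _ _ ((map_ne_zero _).2 hc)]
  have htop := C.adjoin_linRatio_eq_top 1 (by
    rw [inv_one, Units.val_one, linMap_one]; exact h2)
  rw [inv_one, Units.val_one] at htop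
  exact algEquiv_eq_of_adjoin_eq_top htop (hfix 0 2) (hfix 1 2)

end PlaneCurve

/-! ### Derivations on separable extensions -/

/-- A derivation that is zero on M is zero on `l`: expanding P(l + ε d) = 0 for the minimal
polynomial P gives P'(l) d = 0, and P'(l) ≠ 0 by separability. -/
theorem dualNumber_eq_inl_of_isSeparable {M L E : Type*} [Field M] [Field L] [Field E]
    [Algebra M L] (φ : L →+* DualNumber E) (ι : L →+* E) (hfst : ∀ l, (φ l).fst = ι l)
    (hM : ∀ m : M, φ (algebraMap M L m) = TrivSqZeroExt.inl (ι (algebraMap M L m))) {l : L}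
    (hl : IsSeparable M l) : φ l = TrivSqZeroExt.inl (ι l) := by
  let inlE : E →+* DualNumber E := TrivSqZeroExt.inlHom E E
  set P := minpoly M l with hP
  have hρ : φ.comp (algebraMap M L) = (inlE.comp ι).comp (algebraMap M L) := by
    ext1 m
    exact hM m
  let Q : Polynomial (DualNumber E) := P.map (φ.comp (algebraMap M L))
  have h1 : Q.eval (φ l) = 0 := by
    simp only [Q]
    rw [Polynomial.eval_map, ← Polynomial.hom_eval₂, ← Polynomial.aeval_def, minpoly.aeval,
      map_zero]
  have h2 : ∀ R : Polynomial M, (R.map (φ.comp (algebraMap M L))).eval (inlE (ι l)) =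
      inlE (ι (Polynomial.aeval l R)) := by
    intro R
    change _ = (inlE.comp ι) _
    rw [hρ, Polynomial.eval_map, Polynomial.aeval_def, Polynomial.hom_eval₂]
    rfl
  have h3 : φ l = inlE (ι l) + TrivSqZeroExt.inr (φ l).snd := by
    rw [← hfst]
    exact (TrivSqZeroExt.inl_fst_add_inr_snd_eq (φ l)).symm
  have h4 := Polynomial.eval_add_of_sq_eq_zero Q (inlE (ι l)) (TrivSqZeroExt.inr (φ l).snd)
    (by rw [pow_two, TrivSqZeroExt.inr_mul_inr])
  rw [← h3, h1, Polynomial.derivative_map, h2, h2, minpoly.aeval, map_zero, map_zero,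
    zero_add] at h4
  have h5 := congrArg TrivSqZeroExt.snd h4
  simp only [inlE, TrivSqZeroExt.inlHom_apply, TrivSqZeroExt.snd_mul, TrivSqZeroExt.fst_inl,
    TrivSqZeroExt.snd_inr, TrivSqZeroExt.snd_inl, TrivSqZeroExt.snd_zero, smul_eq_mul,
    smul_zero, add_zero] at h5
  have h6 : ι (Polynomial.aeval l (Polynomial.derivative P)) ≠ 0 :=
    (map_ne_zero ι).2 (Polynomial.Separable.aeval_derivative_ne_zero hl (minpoly.aeval M l))
  rw [h3, (mul_eq_zero.1 h5.symm).resolve_left h6, TrivSqZeroExt.inr_zero, add_zero]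
  rfl

theorem exists_GL_with_column {K : Type*} [Field K] {u : Fin 3 → K} (hu : u ≠ 0) :
    ∃ S : GL (Fin 3) K, ∀ i, (S : Matrix (Fin 3) (Fin 3) K) i 0 = u i := by
  have key : ∀ A : Matrix (Fin 3) (Fin 3) K, A.det ≠ 0 → (∀ i, A i 0 = u i) →
      ∃ S : GL (Fin 3) K, ∀ i, (S : Matrix (Fin 3) (Fin 3) K) i 0 = u i :=
    fun A hA h => ⟨Matrix.GeneralLinearGroup.mkOfDetNeZero A hA, h⟩
  obtain ⟨j, hj⟩ := Function.ne_iff.1 hu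
  have hj' : u j ≠ 0 := hj
  fin_cases j
  · refine key !![u 0, 0, 0; u 1, 1, 0; u 2, 0, 1] ?_ (fun i => by fin_cases i <;> rfl)
    simpa [Matrix.det_fin_three] using hj'
  · refine key !![u 0, 1, 0; u 1, 0, 0; u 2, 0, 1] ?_ (fun i => by fin_cases i <;> rfl)
    simpa [Matrix.det_fin_three] using hj'
  · refine key !![u 0, 1, 0; u 1, 0, 1; u 2, 0, 0] ?_ (fun i => by fin_cases i <;> rfl)
    simpa [Matrix.det_fin_three] using hj'

/-! ### Tangent lines and homologies -/

namespace PlaneCurve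

variable {k K : Type*} [Field k] [Field K] [Algebra k K] (C : PlaneCurve k K)

theorem exists_z_ne_zero {p r : ℕ} (hp : p ≠ 0)
    (hg : ∀ (c : C.CoordField) (v : Fin 3 → K),
      ¬ ∀ i, C.gaussMap i = c * algebraMap K C.CoordField (v i))
    {z : Fin 3 → C.functionField} (hz : C.IsSeparableGaussMap p r z) : ∃ j, z j ≠ 0 := by
  by_contra h
  push Not at h
  obtain ⟨⟨c, hc, hzc⟩, -⟩ := hz
  apply hg 0 0
  intro i
  have h1 := hzc i
  rw [h i, ZeroMemClass.coe_zero, zero_pow (pow_ne_zero r hp)] at h1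
  rw [zero_mul]
  exact (mul_eq_zero.1 h1.symm).resolve_left hc

/-- An automorphism that fixes the image of the generic point under the Gauss map moves the
generic point along its tangent line. -/
theorem sum_gaussMap_mul_linMap {p r : ℕ} (hp : p ≠ 0)
    (hg : ∀ (c : C.CoordField) (v : Fin 3 → K),
      ¬ ∀ i, C.gaussMap i = c * algebraMap K C.CoordField (v i))
    {z : Fin 3 → C.functionField} (hz : C.IsSeparableGaussMap p r z)
    {τ : C.functionField ≃ₐ[K] C.functionField} (hτ : ∀ x ∈ ratioField K z, τ x = x)
    {B : Matrix (Fin 3) (Fin 3) K} (hτB : ∀ i j, τ (C.linRatio 1 i j) = C.linRatio B i j)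
    (hB : C.linMap B 0 ≠ 0) : ∑ i, C.gaussMap i * C.linMap B i = 0 := by
  obtain ⟨j, hj⟩ := C.exists_z_ne_zero hp hg hz
  obtain ⟨⟨c, hc, hzc⟩, -⟩ := hz
  have hj' : (z j : C.CoordField) ^ p ^ r ≠ 0 := by
    refine pow_ne_zero _ fun h => hj (Subtype.ext h)
  -- The incidence relation is rewritten with (z_i / z_j)^(p^r), which τ fixes, and X_i / X_0, which
  -- τ sends to (B X)_i / (B X)_0.
  have key : ∀ D : Matrix (Fin 3) (Fin 3) K,
      ((∑ i, (z i / z j) ^ p ^ r * C.linRatio D i 0 : C.functionField) : C.CoordField) =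
      c / (z j : C.CoordField) ^ p ^ r / C.linMap D 0 * ∑ i, C.gaussMap i * C.linMap D i := by
    intro D
    rw [IntermediateField.coe_sum, Finset.mul_sum]
    refine Finset.sum_congr rfl fun i _ => ?_
    change ((z i : C.CoordField) / (z j : C.CoordField)) ^ p ^ r *
      (C.linMap D i / C.linMap D 0) = _
    rw [div_pow, hzc i]
    ring
  have h0 : (∑ i, (z i / z j) ^ p ^ r * C.linRatio 1 i 0 : C.functionField) = 0 := by
    apply Subtype.ext
    rw [key, linMap_one]
    simp_rw [mul_comm (C.gaussMap _)]
    rw [sum_coord_mul_gaussMap, mul_zero]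
    rfl
  have h1 := congrArg τ h0
  simp only [map_sum, map_mul, map_pow, map_zero, hτB] at h1
  simp only [hτ _ (div_mem_ratioField z _ _)] at h1
  have h2 := congrArg Subtype.val h1
  rw [key] at h2
  exact (mul_eq_zero.1 h2).resolve_left (div_ne_zero (div_ne_zero hc hj') hB)

/-- The homogeneous coordinates of the tangent line in the coordinates defined by `T`. -/
def tangentCoord (T : Matrix (Fin 3) (Fin 3) K) (m : Fin 3) : C.CoordField :=
  ∑ l, algebraMap K C.CoordField (T l m) * C.gaussMap l

theorem gaussMap_eq_sum_tangentCoord (T : GL (Fin 3) K) (i : Fin 3) :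
    C.gaussMap i = ∑ m, algebraMap K C.CoordField
      (((T⁻¹ : GL (Fin 3) K) : Matrix (Fin 3) (Fin 3) K) m i) * C.tangentCoord T m := by
  have hTR : (T : Matrix (Fin 3) (Fin 3) K) *
      ((T⁻¹ : GL (Fin 3) K) : Matrix (Fin 3) (Fin 3) K) = 1 := by
    rw [← Units.val_mul, mul_inv_cancel, Units.val_one]
  simp_rw [tangentCoord, Finset.mul_sum]
  rw [Finset.sum_comm]
  have h : ∀ l, ∑ m, algebraMap K C.CoordField
      (((T⁻¹ : GL (Fin 3) K) : Matrix (Fin 3) (Fin 3) K) m i) *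
        (algebraMap K C.CoordField ((T : Matrix (Fin 3) (Fin 3) K) l m) * C.gaussMap l) =
      algebraMap K C.CoordField ((1 : Matrix (Fin 3) (Fin 3) K) l i) * C.gaussMap l := by
    intro l
    rw [← hTR, Matrix.mul_apply, map_sum, Finset.sum_mul]
    refine Finset.sum_congr rfl fun m _ => ?_
    rw [map_mul]
    ring
  simp_rw [h]
  rw [Finset.sum_eq_single i (by
    intro l _ hl
    rw [Matrix.one_apply_ne hl, map_zero, zero_mul]) (by simp), Matrix.one_apply_eq, map_one,
    one_mul]

/-- Points transform by T⁻¹ and lines by the transpose of T, so incidence is preserved. -/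
theorem sum_tangentCoord_mul_linMap (T : GL (Fin 3) K) :
    ∑ m, C.tangentCoord T m *
      C.linMap ((T⁻¹ : GL (Fin 3) K) : Matrix (Fin 3) (Fin 3) K) m = 0 := by
  rw [← C.sum_coord_mul_gaussMap]
  simp_rw [C.gaussMap_eq_sum_tangentCoord T, linMap_apply, Finset.mul_sum]
  rw [Finset.sum_comm]
  exact Finset.sum_congr rfl fun _ _ => Finset.sum_congr rfl fun _ _ => by ring

/-- A matrix of finite order prime to the characteristic that moves the generic point along its
tangent line is a homology, whose centre lies on all the tangent lines. -/
theorem exists_homology [IsAlgClosed K]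
    (hli : ∀ a : Fin 3 → K, ∑ i, algebraMap K C.CoordField (a i) * C.coord i = 0 → a = 0)
    (hγ0 : ∃ i, C.gaussMap i ≠ 0) {A : Matrix (Fin 3) (Fin 3) K} (hA : IsUnit A) {n : ℕ}
    (hn : (n : K) ≠ 0) {c : K} (hAn : A ^ n = Matrix.scalar (Fin 3) c)
    (hγ : ∀ m : ℕ, ∑ i, C.gaussMap i * C.linMap (A ^ m) i = 0) :
    ∃ (a : K) (u b : Fin 3 → K), a ≠ 0 ∧ A = Matrix.scalar (Fin 3) a + Matrix.vecMulVec u b ∧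
      ∑ i, algebraMap K C.CoordField (u i) * C.gaussMap i = 0 := by
  have hc : c ≠ 0 := by
    rintro rfl
    have := hA.pow n
    rw [hAn, map_zero] at this
    exact not_isUnit_zero this
  obtain ⟨S, d, hSd⟩ := exists_conj_diagonal A hn hc hAn
  set R : Matrix (Fin 3) (Fin 3) K := ((S⁻¹ : GL (Fin 3) K) : Matrix (Fin 3) (Fin 3) K) with hR
  have hSR : (S : Matrix (Fin 3) (Fin 3) K) * R = 1 := by
    rw [hR, ← Units.val_mul, mul_inv_cancel, Units.val_one]
  have hpow : ∀ m : ℕ, A ^ m * (S : Matrix (Fin 3) (Fin 3) K) =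
      S * Matrix.diagonal (fun i => d i ^ m) := by
    intro m
    induction m with
    | zero => simp
    | succ m ih =>
      rw [pow_succ, mul_assoc, hSd, ← mul_assoc, ih, mul_assoc, Matrix.diagonal_mul_diagonal]
      simp_rw [pow_succ]
  let δ : Fin 3 → C.CoordField := fun m =>
    ∑ i, algebraMap K C.CoordField ((S : Matrix (Fin 3) (Fin 3) K) i m) * C.gaussMap i
  have hγδ : ∀ i, C.gaussMap i = ∑ m, algebraMap K C.CoordField (R m i) * δ m := by
    intro i
    rw [C.gaussMap_eq_sum_tangentCoord S i]
    rfl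
  -- With tangent and point coordinates taken in the eigenbasis, ∑ g_i d_i^m is the pairing of γ
  -- with A^m X.
  let g : Fin 3 → C.CoordField := fun m => δ m * C.linMap R m
  have ht : ∀ m, C.linMap R m ≠ 0 := C.linMap_ne_zero hli (Units.isUnit S⁻¹)
  have hg0 : g ≠ 0 := by
    intro h
    obtain ⟨i, hi⟩ := hγ0
    apply hi
    rw [hγδ]
    refine Finset.sum_eq_zero fun m _ => ?_
    rw [(mul_eq_zero.1 (congrFun h m)).resolve_right (ht m), mul_zero]
  have hvan : ∀ m : ℕ, ∑ i, g i * (algebraMap K C.CoordField (d i)) ^ m = 0 := by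
    intro m
    have hAm : A ^ m = S * (Matrix.diagonal (fun i => d i ^ m) * R) := by
      rw [← mul_assoc, ← hpow, mul_assoc, hSR, mul_one]
    have h1 : ∀ i, C.linMap (A ^ m) i = ∑ l, algebraMap K C.CoordField
        ((S : Matrix (Fin 3) (Fin 3) K) i l) *
          ((algebraMap K C.CoordField (d l)) ^ m * C.linMap R l) := by
      intro i
      rw [hAm, linMap_mul_apply]
      refine Finset.sum_congr rfl fun l _ => ?_
      rw [linMap_mul_apply, Finset.sum_eq_single l (by
        intro l' _ hl
        rw [Matrix.diagonal_apply_ne' _ hl, map_zero, zero_mul]) (by simp),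
        Matrix.diagonal_apply_eq, map_pow]
    rw [← hγ m]
    simp_rw [h1, g, δ, Finset.mul_sum, Finset.sum_mul]
    rw [Finset.sum_comm]
    exact Finset.sum_congr rfl fun _ _ => Finset.sum_congr rfl fun _ _ => by ring
  obtain ⟨j, hj1, hj2⟩ := vandermonde_three_degenerate hg0 hvan
  have hj1' : ∀ i l, i ≠ j → l ≠ j → d i = d l := fun i l hi hl =>
    (algebraMap K C.CoordField).injective (hj1 i l hi hl)
  obtain ⟨i₀, hi₀⟩ : ∃ i : Fin 3, i ≠ j := exists_ne j
  -- The eigenvalues other than d_j coincide, so the diagonal matrix is scalar plus a multiple of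
  -- E_jj. Conjugating E_jj by S gives column j of S times row j of its inverse.
  have hform : A = Matrix.scalar (Fin 3) (d i₀) +
      Matrix.vecMulVec (fun i => (d j - d i₀) * (S : Matrix (Fin 3) (Fin 3) K) i j) (R j) := by
    have hd : Matrix.diagonal d = Matrix.scalar (Fin 3) (d i₀) +
        Matrix.diagonal (Pi.single j (d j - d i₀)) := by
      rw [Matrix.scalar_apply, Matrix.diagonal_add]
      congr 1
      ext i
      by_cases hi : i = j
      · subst hi; simp
      · rw [Pi.single_eq_of_ne hi, add_zero, hj1' i i₀ hi hi₀]
    have hA' : A = S * Matrix.diagonal d * R := by rw [← hSd, mul_assoc, hSR, mul_one]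
    rw [hA', hd, mul_add, add_mul]
    congr 1
    · rw [← (Matrix.scalar_commute (d i₀) (fun r => mul_comm _ _) _).eq, mul_assoc, hSR, mul_one]
    · ext i l
      rw [Matrix.mul_apply, Finset.sum_eq_single j (by
        intro m _ hm
        rw [Matrix.mul_diagonal, Pi.single_eq_of_ne hm, mul_zero, zero_mul]) (by simp),
        Matrix.mul_diagonal, Pi.single_eq_same, Matrix.vecMulVec_apply]
      ring
  refine ⟨d i₀, fun i => (d j - d i₀) * (S : Matrix (Fin 3) (Fin 3) K) i j, R j, ?_, hform, ?_⟩
  -- With a = 0, A would have rank at most one and could not be invertible.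
  · intro h0
    rw [h0, map_zero, zero_add] at hform
    rw [Matrix.isUnit_iff_isUnit_det, hform, Matrix.det_fin_three] at hA
    simp only [Matrix.vecMulVec_apply] at hA
    refine not_isUnit_zero (?_ : IsUnit (0 : K))
    convert hA using 1
    ring
  · have h3 : algebraMap K C.CoordField (d j - d i₀) * δ j = 0 := by
      rcases hj2 i₀ hi₀ with h | h
      · rw [map_sub, h, sub_self, zero_mul]
      · rw [(mul_eq_zero.1 h).resolve_right (ht j), mul_zero]
    rw [← h3]
    simp only [δ, Finset.mul_sum, map_mul, mul_assoc]

end PlaneCurve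

/-! ### The tangent equation and inseparability -/

theorem dualNumber_hom_sum {K E ι : Type*} [Field K] [Field E] [Algebra K E] [Fintype ι]
    (φ : E →ₐ[K] DualNumber E) {x : ι → E} {u : ι → K}
    (hx : ∀ i, φ (x i) = TrivSqZeroExt.inl (x i) + TrivSqZeroExt.inr (algebraMap K E (u i)))
    (a : ι → K) :
    φ (∑ i, algebraMap K E (a i) * x i) = TrivSqZeroExt.inl (∑ i, algebraMap K E (a i) * x i) +
      TrivSqZeroExt.inr (algebraMap K E (∑ i, a i * u i)) := by
  simp_rw [← Algebra.smul_def, map_sum, map_smul, hx, map_mul]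
  rw [TrivSqZeroExt.inl_sum, TrivSqZeroExt.inr_sum, ← Finset.sum_add_distrib]
  refine Finset.sum_congr rfl fun i _ => ?_
  rw [smul_add, TrivSqZeroExt.inl_smul, ← Algebra.smul_def, TrivSqZeroExt.inr_smul]

/-- This is the field of constants of the derivation encoded by `φ`. -/
theorem exists_intermediateField_dualNumber_eq_inl {K E : Type*} [Field K] [Field E]
    [Algebra K E] (φ : E →ₐ[K] DualNumber E) :
    ∃ Z : IntermediateField K E, ∀ x, x ∈ Z ↔ φ x = TrivSqZeroExt.inl x := by
  let ι : E →ₐ[K] DualNumber E := TrivSqZeroExt.inlAlgHom K E E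
  refine ⟨(AlgHom.equalizer φ ι).toIntermediateField ?_, fun x => Iff.rfl⟩
  intro x hx
  by_cases hx0 : x = 0
  · rw [hx0, inv_zero]; exact zero_mem _
  · have hx' : φ x = ι x := hx
    have h1 : φ x * φ x⁻¹ = 1 := by rw [← map_mul, mul_inv_cancel₀ hx0, map_one]
    have h3 : ι x * ι x⁻¹ = 1 := by rw [← map_mul, mul_inv_cancel₀ hx0, map_one]
    change φ x⁻¹ = ι x⁻¹
    rw [hx'] at h1
    calc φ x⁻¹ = (ι x * ι x⁻¹) * φ x⁻¹ := by rw [h3, one_mul]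
      _ = (ι x * φ x⁻¹) * ι x⁻¹ := by ring
      _ = ι x⁻¹ := by rw [h1, one_mul]

theorem mul_pow_add_mul_pow_eq_zero {E : Type*} [Field E] {a₁ a₂ b₁ b₂ y : E} {q : ℕ}
    (hb₁ : b₁ ≠ 0) (hb₂ : b₂ ≠ 0) (h : (a₁ / b₁) ^ q * y + (a₂ / b₂) ^ q = 0) :
    (a₁ * b₂) ^ q * y + (a₂ * b₁) ^ q = 0 := by
  have h1 : a₁ * b₂ = (a₁ / b₁) * (b₁ * b₂) := by field_simp
  have h2 : a₂ * b₁ = (a₂ / b₂) * (b₁ * b₂) := by field_simp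
  rw [h1, h2, mul_pow, mul_pow (a₂ / b₂)]
  linear_combination (b₁ * b₂) ^ q * h

theorem exists_eq_aeval_div_of_mem_adjoin_range {K L ι : Type*} [Field K] [Field L] [Algebra K L]
    {v : ι → L} {w : L} (hw : w ∈ IntermediateField.adjoin K (Set.range v)) :
    ∃ a b : MvPolynomial ι K, aeval v b ≠ 0 ∧ w = aeval v a / aeval v b := by
  rw [IntermediateField.mem_adjoin_range_iff] at hw
  obtain ⟨a, b, e⟩ := hw
  -- With a zero denominator the quotient is 0 by convention, so 0 / 1 represents it.
  by_cases hb : aeval v b = 0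
  · exact ⟨0, 1, by simp, by rw [e, hb]; simp⟩
  · exact ⟨a, b, hb, e⟩

namespace PlaneCurve

variable {k K : Type*} [Field k] [Field K] [Algebra k K] (C : PlaneCurve k K)

/-- If all tangent lines pass through the point `T (1 : 0 : 0)`, the equation of the tangent line
at the generic point `(x, y)` is `w₁ ^ p ^ r * Y + w₂ ^ p ^ r = 0`, with `w₁`, `w₂` in the function
field of the image of the separable part of the Gauss map. -/
theorem exists_tangent_equation [IsAlgClosed K] {p r : ℕ} [Fact p.Prime] [CharP K p]
    (hg : ∀ (c : C.CoordField) (v : Fin 3 → K),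
      ¬ ∀ i, C.gaussMap i = c * algebraMap K C.CoordField (v i))
    {z : Fin 3 → C.functionField} (hz : C.IsSeparableGaussMap p r z) (T : GL (Fin 3) K)
    (hT0 : C.tangentCoord T 0 = 0)
    (h2 : C.linMap ((T⁻¹ : GL (Fin 3) K) : Matrix (Fin 3) (Fin 3) K) 2 ≠ 0) :
    ∃ w₁ ∈ ratioField K z, ∃ w₂ ∈ ratioField K z, w₁ ≠ 0 ∧
      w₁ ^ p ^ r * C.linRatio ((T⁻¹ : GL (Fin 3) K) : Matrix (Fin 3) (Fin 3) K) 1 2 +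
        w₂ ^ p ^ r = 0 := by
  have hp : p.Prime := Fact.out
  have : CharP C.functionField p := charP_of_injective_algebraMap
    (algebraMap K C.functionField).injective p
  obtain ⟨j, hj⟩ := C.exists_z_ne_zero hp.ne_zero hg hz
  obtain ⟨⟨c, hc, hzc⟩, -⟩ := hz
  have hj' : (z j : C.CoordField) ^ p ^ r ≠ 0 := by
    refine pow_ne_zero _ fun h => hj (Subtype.ext h)
  have hroot : ∀ a : K, ∃ b : K, b ^ p ^ r = a := fun a =>
    IsAlgClosed.exists_pow_nat_eq a (pow_pos hp.pos r)
  choose ρ hρ using hroot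
  -- Using p^r-th roots of the entries of T and additivity of Frobenius, w_m^(p^r) is the m-th
  -- tangent coordinate up to a common factor.
  let w : Fin 3 → C.functionField := fun m =>
    ∑ l, algebraMap K C.functionField (ρ ((T : Matrix (Fin 3) (Fin 3) K) l m)) * (z l / z j)
  have hwmem : ∀ m, w m ∈ ratioField K z := fun m =>
    sum_mem fun l _ => mul_mem ((ratioField K z).algebraMap_mem _) (div_mem_ratioField z l j)
  have hwpow : ∀ m, ((w m ^ p ^ r : C.functionField) : C.CoordField) =
      c / (z j : C.CoordField) ^ p ^ r * C.tangentCoord T m := by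
    intro m
    simp only [w]
    rw [sum_pow_char_pow, IntermediateField.coe_sum, tangentCoord, Finset.mul_sum]
    refine Finset.sum_congr rfl fun l _ => ?_
    rw [mul_pow, ← map_pow, hρ]
    change algebraMap K C.CoordField _ * ((z l : C.CoordField) / (z j : C.CoordField)) ^ p ^ r = _
    rw [div_pow, hzc l]
    ring
  have hrel := C.sum_tangentCoord_mul_linMap T
  rw [Fin.sum_univ_three, hT0, zero_mul, zero_add] at hrel
  refine ⟨w 1, hwmem 1, w 2, hwmem 2, ?_, ?_⟩
  · intro h
    have h1 := hwpow 1
    rw [h, zero_pow (pow_ne_zero r hp.ne_zero)] at h1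
    have h3 : C.tangentCoord T 1 = 0 :=
      (mul_eq_zero.1 h1.symm).resolve_left (div_ne_zero hc hj')
    rw [h3, zero_mul, zero_add] at hrel
    have h4 : C.tangentCoord T 2 = 0 := (mul_eq_zero.1 hrel).resolve_right h2
    apply hg 0 0
    intro i
    rw [C.gaussMap_eq_sum_tangentCoord T, Fin.sum_univ_three, hT0, h3, h4]
    simp
  · apply Subtype.ext
    rw [IntermediateField.coe_add, IntermediateField.coe_mul, hwpow, hwpow, coe_linRatio]
    change _ = (0 : C.CoordField)
    field_simp
    linear_combination c * hrel

/-- The Gauss map of a curve whose tangent lines all pass through one point is inseparable. -/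
theorem pos_of_tangentCoord_eq_zero {p r : ℕ}
    (hg : ∀ (c : C.CoordField) (v : Fin 3 → K),
      ¬ ∀ i, C.gaussMap i = c * algebraMap K C.CoordField (v i))
    {z : Fin 3 → C.functionField} (hz : C.IsSeparableGaussMap p r z) (T : GL (Fin 3) K)
    (hT0 : C.tangentCoord T 0 = 0)
    (h2 : C.linMap ((T⁻¹ : GL (Fin 3) K) : Matrix (Fin 3) (Fin 3) K) 2 ≠ 0) : 0 < r := by
  rw [Nat.pos_iff_ne_zero]
  rintro rfl
  obtain ⟨⟨c, hc, hzc⟩, hsep⟩ := hz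
  set S : Matrix (Fin 3) (Fin 3) K := ((T⁻¹ : GL (Fin 3) K) : Matrix (Fin 3) (Fin 3) K) with hS
  have hST : S * (T : Matrix (Fin 3) (Fin 3) K) = 1 := by
    rw [hS, ← Units.val_mul, inv_mul_cancel, Units.val_one]
  -- `φ` encodes the derivation ∂/∂X'₀, where X' = T⁻¹ X. It descends to the curve because all
  -- tangent lines pass through the centre.
  obtain ⟨φ, hφ1, hφ2⟩ := C.exists_dualNumber_hom
    (fun i => (T : Matrix (Fin 3) (Fin 3) K) i 0) hT0
  have hφlin : ∀ m, φ (C.linMap S m) = TrivSqZeroExt.inl (C.linMap S m) +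
      TrivSqZeroExt.inr (algebraMap K C.CoordField ((1 : Matrix (Fin 3) (Fin 3) K) m 0)) := by
    intro m
    rw [← hST, Matrix.mul_apply, linMap_apply]
    exact dualNumber_hom_sum φ hφ2 (S m)
  obtain ⟨Z, hZ⟩ := exists_intermediateField_dualNumber_eq_inl φ
  have h1Z : C.linMap S 1 ∈ Z := by
    rw [hZ, hφlin, Matrix.one_apply_ne (by decide), map_zero, TrivSqZeroExt.inr_zero, add_zero]
  have h2Z : C.linMap S 2 ∈ Z := by
    rw [hZ, hφlin, Matrix.one_apply_ne (by decide), map_zero, TrivSqZeroExt.inr_zero, add_zero]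
  have hrel := C.sum_tangentCoord_mul_linMap T
  rw [Fin.sum_univ_three, hT0, zero_mul, zero_add] at hrel
  set y := C.linMap S 1 / C.linMap S 2 with hy
  have hyZ : y ∈ Z := div_mem h1Z h2Z
  have hδ2 : C.tangentCoord T 2 = -(y * C.tangentCoord T 1) := by
    rw [hy]
    field_simp
    linear_combination hrel
  -- In the new coordinates the tangent line is (0 : 1 : -y), so with r = 0 the ratios of the z_i
  -- lie in K(y), which the derivation kills.
  have hγ : ∀ i, C.gaussMap i = C.tangentCoord T 1 *
      (algebraMap K C.CoordField (S 1 i) - algebraMap K C.CoordField (S 2 i) * y) := by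
    intro i
    rw [C.gaussMap_eq_sum_tangentCoord T, Fin.sum_univ_three, hT0, hδ2]
    ring
  have hδ1 : C.tangentCoord T 1 ≠ 0 := by
    intro h
    apply hg 0 0
    intro i
    rw [hγ, h, zero_mul, zero_mul]
  have hle : ratioField K z ≤ Z.comap C.functionField.val := by
    rw [ratioField, IntermediateField.adjoin_le_iff]
    rintro _ ⟨i, j, rfl⟩
    change ((z i : C.CoordField) / (z j : C.CoordField)) ∈ Z
    have h3 : ∀ i, (z i : C.CoordField) = c * C.gaussMap i := by
      intro i
      rw [← hzc, pow_zero, pow_one]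
    rw [h3, h3, mul_div_mul_left _ _ hc, hγ, hγ, mul_div_mul_left _ _ hδ1]
    have h4 : ∀ i, algebraMap K C.CoordField (S 1 i) - algebraMap K C.CoordField (S 2 i) * y ∈ Z :=
      fun i => sub_mem (Z.algebraMap_mem _) (mul_mem (Z.algebraMap_mem _) hyZ)
    exact div_mem (h4 i) (h4 j)
  have hx : φ (C.linRatio S 0 2 : C.CoordField) =
      TrivSqZeroExt.inl (C.linRatio S 0 2 : C.CoordField) :=
    dualNumber_eq_inl_of_isSeparable (M := ratioField K z)
      ((φ : C.CoordField →+* DualNumber C.CoordField).comp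
        (C.functionField.val : C.functionField →+* C.CoordField))
      (C.functionField.val : C.functionField →+* C.CoordField) (fun l => hφ1 _)
      (fun m => (hZ _).1 (hle m.2)) (Algebra.IsSeparable.isSeparable (ratioField K z) (C.linRatio S 0 2))
  -- By separability x is killed too, hence so is X'₀ = x X'₂, although its derivative is 1.
  have h0Z : C.linMap S 0 ∈ Z := by
    have h5 : C.linMap S 0 = (C.linRatio S 0 2 : C.CoordField) * C.linMap S 2 := by
      rw [coe_linRatio, div_mul_cancel₀ _ h2]
    rw [h5]
    exact mul_mem ((hZ _).2 hx) h2Z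
  have h6 := hφlin 0
  rw [(hZ _).1 h0Z, Matrix.one_apply_eq, map_one, left_eq_add] at h6
  exact one_ne_zero (TrivSqZeroExt.inr_injective h6)

theorem coe_aeval_substPow (n : ℕ) {S : Matrix (Fin 3) (Fin 3) K} (g : MvPolynomial (Fin 2) K) :
    aeval ![C.linMap S 0 / C.linMap S 2, C.linMap S 1 / C.linMap S 2] (substPow n g) =
      ((aeval ![C.linRatio S 0 2 ^ n, C.linRatio S 1 2] g : C.functionField) : C.CoordField) := by
  rw [substPow, ← AlgHom.comp_apply, comp_aeval]
  change _ = C.functionField.val _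
  rw [← AlgHom.comp_apply, comp_aeval]
  congr 2
  ext i
  fin_cases i
  · simp [coe_linRatio]
  · simp [coe_linRatio]

/-- Rational functions of `x ^ n` and `y` that satisfy the equation of the tangent line give a
polynomial that is divisible by the polynomial of the curve. -/
theorem exists_polynomials_of_tangent_equation (T : GL (Fin 3) K)
    (h2 : C.linMap ((T⁻¹ : GL (Fin 3) K) : Matrix (Fin 3) (Fin 3) K) 2 ≠ 0) {n q : ℕ}
    {w₁ w₂ : C.functionField}
    (h₁ : w₁ ∈ IntermediateField.adjoin K (Set.range
      ![C.linRatio ((T⁻¹ : GL (Fin 3) K) : Matrix (Fin 3) (Fin 3) K) 0 2 ^ n,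
        C.linRatio ((T⁻¹ : GL (Fin 3) K) : Matrix (Fin 3) (Fin 3) K) 1 2]))
    (h₂ : w₂ ∈ IntermediateField.adjoin K (Set.range
      ![C.linRatio ((T⁻¹ : GL (Fin 3) K) : Matrix (Fin 3) (Fin 3) K) 0 2 ^ n,
        C.linRatio ((T⁻¹ : GL (Fin 3) K) : Matrix (Fin 3) (Fin 3) K) 1 2]))
    (hw : w₁ ≠ 0)
    (h : w₁ ^ q * C.linRatio ((T⁻¹ : GL (Fin 3) K) : Matrix (Fin 3) (Fin 3) K) 1 2 +
      w₂ ^ q = 0) :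
    ∃ z₁ z₂ : MvPolynomial (Fin 2) K,
      C.affinePoly T ∣ substPow n z₁ ^ q * MvPolynomial.X 1 + substPow n z₂ ^ q ∧
      ¬ C.affinePoly T ∣ substPow n z₁ := by
  set S : Matrix (Fin 3) (Fin 3) K := ((T⁻¹ : GL (Fin 3) K) : Matrix (Fin 3) (Fin 3) K) with hS
  have hTS : (T : Matrix (Fin 3) (Fin 3) K) * S = 1 := by
    rw [hS, ← Units.val_mul, mul_inv_cancel, Units.val_one]
  have htT : ((T : Matrix (Fin 3) (Fin 3) K).map (algebraMap K C.CoordField)).mulVec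
      (C.linMap S) = C.coord := by
    rw [← linMap_mul, hTS, linMap_one]
  obtain ⟨a₁, b₁, hb₁, e₁⟩ := exists_eq_aeval_div_of_mem_adjoin_range h₁
  obtain ⟨a₂, b₂, hb₂, e₂⟩ := exists_eq_aeval_div_of_mem_adjoin_range h₂
  set v := ![C.linRatio S 0 2 ^ n, C.linRatio S 1 2] with hv
  have ha₁ : aeval v a₁ ≠ 0 := fun h0 => hw (by rw [e₁, h0, zero_div])
  have hsub : ∀ g, aeval ![C.linMap S 0 / C.linMap S 2, C.linMap S 1 / C.linMap S 2]
      (substPow n g) = ((aeval v g : C.functionField) : C.CoordField) := C.coe_aeval_substPow n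
  rw [e₁, e₂] at h
  -- Numerators of w₁ = a₁ / b₁ and w₂ = a₂ / b₂ over the common denominator b₁ b₂.
  refine ⟨a₁ * b₂, a₂ * b₁, ?_, ?_⟩
  · rw [← C.aeval_eq_zero_iff_affinePoly_dvd T htT h2, map_add, map_mul, map_pow, map_pow,
      aeval_X, hsub, hsub, map_mul, map_mul]
    exact congrArg Subtype.val (mul_pow_add_mul_pow_eq_zero hb₁ hb₂ h)
  · rw [← C.aeval_eq_zero_iff_affinePoly_dvd T htT h2, hsub, map_mul]
    exact fun h0 => mul_ne_zero ha₁ hb₂ (Subtype.ext h0)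

/-! ### Homologies in affine coordinates -/

theorem linRatio_linearIndependent
    (hli : ∀ a : Fin 3 → K, ∑ i, algebraMap K C.CoordField (a i) * C.coord i = 0 → a = 0)
    (S : GL (Fin 3) K) (a b c : K)
    (h : a • C.linRatio (S : Matrix (Fin 3) (Fin 3) K) 0 2 +
      b • C.linRatio (S : Matrix (Fin 3) (Fin 3) K) 1 2 + algebraMap K C.functionField c = 0) :
    a = 0 ∧ b = 0 ∧ c = 0 := by
  have h2 : C.linMap (S : Matrix (Fin 3) (Fin 3) K) 2 ≠ 0 :=
    C.linMap_ne_zero hli (Units.isUnit S) 2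
  have h1 : ∑ m, algebraMap K C.CoordField (![a, b, c] m) *
      C.linMap (S : Matrix (Fin 3) (Fin 3) K) m = 0 := by
    have h3 := congrArg Subtype.val h
    simp only [Algebra.smul_def, IntermediateField.coe_add, IntermediateField.coe_mul,
      coe_linRatio] at h3
    change algebraMap K C.CoordField a * _ + algebraMap K C.CoordField b * _ +
      algebraMap K C.CoordField c = 0 at h3
    rw [Fin.sum_univ_three]
    field_simp at h3
    change algebraMap K C.CoordField a * _ + algebraMap K C.CoordField b * _ +
      algebraMap K C.CoordField c * _ = 0
    linear_combination h3
  have h4 : Matrix.vecMul ![a, b, c] (S : Matrix (Fin 3) (Fin 3) K) = 0 := by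
    apply hli
    rw [← h1]
    simp_rw [linMap_apply, Matrix.vecMul, dotProduct, map_sum, map_mul, Finset.mul_sum,
      Finset.sum_mul]
    rw [Finset.sum_comm]
    exact Finset.sum_congr rfl fun _ _ => Finset.sum_congr rfl fun _ _ => by ring
  have h5 : ![a, b, c] = 0 := by
    have h6 := congrArg (fun w => Matrix.vecMul w
      ((S⁻¹ : GL (Fin 3) K) : Matrix (Fin 3) (Fin 3) K)) h4
    simpa [Matrix.vecMul_vecMul, ← Units.val_mul] using h6
  exact ⟨congrFun h5 0, congrFun h5 1, congrFun h5 2⟩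

/-- A homology with centre `T (1 : 0 : 0)` in affine coordinates. -/
theorem map_linRatio_of_homology
    (hli : ∀ a : Fin 3 → K, ∑ i, algebraMap K C.CoordField (a i) * C.coord i = 0 → a = 0)
    (S : GL (Fin 3) K) {σ : C.functionField ≃ₐ[K] C.functionField}
    {A : Matrix (Fin 3) (Fin 3) K} (hA : IsUnit A)
    (hσ : ∀ i j, σ (C.linRatio 1 i j) = C.linRatio A i j) {a : K} (ha : a ≠ 0) {b : Fin 3 → K}
    (hAb : A = Matrix.scalar (Fin 3) a +
      Matrix.vecMulVec (fun i => (S : Matrix (Fin 3) (Fin 3) K) i 0) b) :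
    σ (C.linRatio ((S⁻¹ : GL (Fin 3) K) : Matrix (Fin 3) (Fin 3) K) 1 2) =
      C.linRatio ((S⁻¹ : GL (Fin 3) K) : Matrix (Fin 3) (Fin 3) K) 1 2 ∧
    ∃ α β κ : K, σ (C.linRatio ((S⁻¹ : GL (Fin 3) K) : Matrix (Fin 3) (Fin 3) K) 0 2) =
      α • C.linRatio ((S⁻¹ : GL (Fin 3) K) : Matrix (Fin 3) (Fin 3) K) 0 2 +
      β • C.linRatio ((S⁻¹ : GL (Fin 3) K) : Matrix (Fin 3) (Fin 3) K) 1 2 +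
      algebraMap K C.functionField κ := by
  set R : Matrix (Fin 3) (Fin 3) K := ((S⁻¹ : GL (Fin 3) K) : Matrix (Fin 3) (Fin 3) K) with hR
  have hRS : R * (S : Matrix (Fin 3) (Fin 3) K) = 1 := by
    rw [hR, ← Units.val_mul, inv_mul_cancel, Units.val_one]
  have hSR : (S : Matrix (Fin 3) (Fin 3) K) * R = 1 := by
    rw [hR, ← Units.val_mul, mul_inv_cancel, Units.val_one]
  have h2 : C.linMap R 2 ≠ 0 := C.linMap_ne_zero hli (Units.isUnit S⁻¹) 2
  let b' : Fin 3 → K := fun l => ∑ i, b i * (S : Matrix (Fin 3) (Fin 3) K) i l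
  -- In coordinates with the centre at (1:0:0), the homology is a scalar matrix altered only in its
  -- first row.
  have hRA : R * A = (Matrix.scalar (Fin 3) a + Matrix.vecMulVec (Pi.single 0 1) b') * R := by
    have h3 : R * A * (S : Matrix (Fin 3) (Fin 3) K) =
        Matrix.scalar (Fin 3) a + Matrix.vecMulVec (Pi.single 0 1) b' := by
      have hv1 : R.mulVec (fun i => (S : Matrix (Fin 3) (Fin 3) K) i 0) = Pi.single 0 1 := by
        ext i
        change (R * (S : Matrix (Fin 3) (Fin 3) K)) i 0 = _
        rw [hRS, Matrix.one_apply, Pi.single_apply]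
      rw [hAb, mul_add, add_mul, Matrix.mul_vecMulVec, hv1, Matrix.vecMulVec_mul]
      congr 1
      rw [← (Matrix.scalar_commute a (fun r => mul_comm _ _) _).eq, mul_assoc, hRS, mul_one]
    rw [← h3, mul_assoc, hSR, mul_one]
  have hlin : ∀ m, C.linMap (R * A) m = algebraMap K C.CoordField a * C.linMap R m +
      algebraMap K C.CoordField ((Pi.single 0 1 : Fin 3 → K) m) *
        ∑ l, algebraMap K C.CoordField (b' l) * C.linMap R l := by
    intro m
    rw [hRA, linMap_mul_apply, Finset.mul_sum]
    simp only [Matrix.add_apply, map_add, add_mul, Finset.sum_add_distrib]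
    congr 1
    · rw [Finset.sum_eq_single m (by
        intro l _ hl
        rw [Matrix.scalar_apply, Matrix.diagonal_apply_ne' _ hl, map_zero, zero_mul]) (by simp),
        Matrix.scalar_apply, Matrix.diagonal_apply_eq]
    · refine Finset.sum_congr rfl fun l _ => ?_
      rw [Matrix.vecMulVec_apply, map_mul, mul_assoc]
  have haE : algebraMap K C.CoordField a ≠ 0 := (map_ne_zero _).2 ha
  have hl1 : C.linMap (R * A) 1 = algebraMap K C.CoordField a * C.linMap R 1 := by
    rw [hlin]; simp
  have hl2 : C.linMap (R * A) 2 = algebraMap K C.CoordField a * C.linMap R 2 := by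
    rw [hlin]; simp
  have hl0 : C.linMap (R * A) 0 = algebraMap K C.CoordField a * C.linMap R 0 +
        ∑ l, algebraMap K C.CoordField (b' l) * C.linMap R l := by
    rw [hlin]; simp
  refine ⟨?_, 1 + b' 0 / a, b' 1 / a, b' 2 / a, ?_⟩
  · rw [C.map_linRatio hli hA hσ]
    apply Subtype.ext
    rw [coe_linRatio, coe_linRatio, hl1, hl2, mul_div_mul_left _ _ haE]
  · rw [C.map_linRatio hli hA hσ]
    apply Subtype.ext
    simp only [Algebra.smul_def, IntermediateField.coe_add, IntermediateField.coe_mul,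
      coe_linRatio]
    rw [hl0, hl2, Fin.sum_univ_three]
    change _ = algebraMap K C.CoordField (1 + b' 0 / a) * (C.linMap R 0 / C.linMap R 2) +
      algebraMap K C.CoordField (b' 1 / a) * (C.linMap R 1 / C.linMap R 2) +
      algebraMap K C.CoordField (b' 2 / a)
    simp only [map_add, map_div₀, map_one]
    field_simp
    ring

end PlaneCurve

/-- A change of coordinates `(x, y) ↦ (x + b y + c, y)`. -/
theorem PlaneCurve.exists_shear {k K : Type*} [Field k] [Field K] [Algebra k K]
    (C : PlaneCurve k K) (S : GL (Fin 3) K)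
    (hS : C.linMap ((S⁻¹ : GL (Fin 3) K) : Matrix (Fin 3) (Fin 3) K) 2 ≠ 0) (b c : K) :
    ∃ T : GL (Fin 3) K,
      (∀ i, (T : Matrix (Fin 3) (Fin 3) K) i 0 = (S : Matrix (Fin 3) (Fin 3) K) i 0) ∧
      C.linRatio ((T⁻¹ : GL (Fin 3) K) : Matrix (Fin 3) (Fin 3) K) 0 2 =
        C.linRatio ((S⁻¹ : GL (Fin 3) K) : Matrix (Fin 3) (Fin 3) K) 0 2 +
        b • C.linRatio ((S⁻¹ : GL (Fin 3) K) : Matrix (Fin 3) (Fin 3) K) 1 2 +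
        algebraMap K C.functionField c ∧
      C.linRatio ((T⁻¹ : GL (Fin 3) K) : Matrix (Fin 3) (Fin 3) K) 1 2 =
        C.linRatio ((S⁻¹ : GL (Fin 3) K) : Matrix (Fin 3) (Fin 3) K) 1 2 := by
  -- N⁻¹ fixes (1, 0, 0), so S and S N⁻¹ have the same first column: the shear keeps the centre.
  let N : GL (Fin 3) K := ⟨!![1, b, c; 0, 1, 0; 0, 0, 1], !![1, -b, -c; 0, 1, 0; 0, 0, 1],
    by ext i j; fin_cases i <;> fin_cases j <;> simp [Matrix.mul_apply, Fin.sum_univ_three],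
    by ext i j; fin_cases i <;> fin_cases j <;> simp [Matrix.mul_apply, Fin.sum_univ_three]⟩
  set R : Matrix (Fin 3) (Fin 3) K := ((S⁻¹ : GL (Fin 3) K) : Matrix (Fin 3) (Fin 3) K) with hR
  have hTinv : (((S * N⁻¹)⁻¹ : GL (Fin 3) K) : Matrix (Fin 3) (Fin 3) K) =
      !![1, b, c; 0, 1, 0; 0, 0, 1] * R := by
    simp only [mul_inv_rev, inv_inv, Units.val_mul]
    rfl
  refine ⟨S * N⁻¹, fun i => ?_, ?_⟩
  · have hTv : ((S * N⁻¹ : GL (Fin 3) K) : Matrix (Fin 3) (Fin 3) K) =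
      S * !![1, -b, -c; 0, 1, 0; 0, 0, 1] := rfl
    rw [hTv, Matrix.mul_apply, Fin.sum_univ_three]
    simp
  rw [hTinv]
  set Q : Matrix (Fin 3) (Fin 3) K := !![1, b, c; 0, 1, 0; 0, 0, 1] * R with hQ
  have hQ0 : C.linMap Q 0 = C.linMap R 0 + algebraMap K C.CoordField b * C.linMap R 1 +
      algebraMap K C.CoordField c * C.linMap R 2 := by
    rw [hQ, PlaneCurve.linMap_mul_apply, Fin.sum_univ_three]
    simp
  have hQ1 : C.linMap Q 1 = C.linMap R 1 := by
    rw [hQ, PlaneCurve.linMap_mul_apply, Fin.sum_univ_three]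
    simp
  have hQ2 : C.linMap Q 2 = C.linMap R 2 := by
    rw [hQ, PlaneCurve.linMap_mul_apply, Fin.sum_univ_three]
    simp
  constructor
  · apply Subtype.ext
    simp only [Algebra.smul_def, IntermediateField.coe_add, IntermediateField.coe_mul,
      PlaneCurve.coe_linRatio]
    change _ = C.linMap R 0 / C.linMap R 2 +
      algebraMap K C.CoordField b * (C.linMap R 1 / C.linMap R 2) + algebraMap K C.CoordField c
    rw [hQ0, hQ2]
    field_simp
  · apply Subtype.ext
    rw [PlaneCurve.coe_linRatio, PlaneCurve.coe_linRatio, hQ1, hQ2]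

/-! ### Common centre of the group and conclusion -/

/-- The group is generated by a diagonal homology whose centre `T (1 : 0 : 0)` lies on all the
tangent lines of the curve. -/
theorem PlaneCurve.exists_homology_coordinates {k K : Type*} [Field k] [Field K] [Algebra k K]
    [IsAlgClosed K] (C : PlaneCurve k K) {p r : ℕ} (hp0 : p ≠ 0)
    (hg : ∀ (c : C.CoordField) (v : Fin 3 → K),
      ¬ ∀ i, C.gaussMap i = c * algebraMap K C.CoordField (v i))
    (hli : ∀ a : Fin 3 → K, ∑ i, algebraMap K C.CoordField (a i) * C.coord i = 0 → a = 0)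
    {z : Fin 3 → C.functionField} (hz : C.IsSeparableGaussMap p r z)
    {G : Subgroup (C.functionField ≃ₐ[K] C.functionField)}
    (hlin : ∀ σ ∈ G, C.IsLinear σ) (hnontrivial : G ≠ ⊥)
    (hfix : ∀ σ ∈ G, ∀ x ∈ ratioField K z, σ x = x)
    {n : ℕ} (hn : Nat.card G = n) (hnK : (n : K) ≠ 0) :
    ∃ (T : GL (Fin 3) K) (ξ : K) (σ : C.functionField ≃ₐ[K] C.functionField),
      C.tangentCoord T 0 = 0 ∧ IsPrimitiveRoot ξ n ∧ G = Subgroup.zpowers σ ∧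
      σ (C.linRatio ((T⁻¹ : GL (Fin 3) K) : Matrix (Fin 3) (Fin 3) K) 0 2) =
        ξ • C.linRatio ((T⁻¹ : GL (Fin 3) K) : Matrix (Fin 3) (Fin 3) K) 0 2 ∧
      σ (C.linRatio ((T⁻¹ : GL (Fin 3) K) : Matrix (Fin 3) (Fin 3) K) 1 2) =
        C.linRatio ((T⁻¹ : GL (Fin 3) K) : Matrix (Fin 3) (Fin 3) K) 1 2 := by
  have hγ0 : ∃ i, C.gaussMap i ≠ 0 := by
    by_contra h
    push Not at h
    exact hg 0 0 fun i => by rw [h i, zero_mul]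
  have hom : ∀ σ ∈ G, ∃ (A : Matrix (Fin 3) (Fin 3) K) (a : K) (u b : Fin 3 → K), IsUnit A ∧
      (∀ i j, σ (C.linRatio 1 i j) = C.linRatio A i j) ∧ a ≠ 0 ∧
      A = Matrix.scalar (Fin 3) a + Matrix.vecMulVec u b ∧
      ∑ i, algebraMap K C.CoordField (u i) * C.gaussMap i = 0 := by
    intro σ hσ
    obtain ⟨A, hA⟩ := hlin σ hσ
    have hAu : IsUnit (A : Matrix (Fin 3) (Fin 3) K) := Units.isUnit A
    have hpow := C.pow_map_linRatio hli hAu hA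
    have hσn : σ ^ n = 1 := by
      have := pow_card_eq_one' (x := (⟨σ, hσ⟩ : G))
      rw [hn] at this
      simpa using congrArg Subtype.val this
    obtain ⟨c, hc⟩ := C.exists_scalar_of_linRatio_eq hli (hAu.pow n) (fun i j => by
      rw [← hpow, hσn]; rfl)
    obtain ⟨a, u, b, ha, hAab, hu⟩ := C.exists_homology hli hγ0 hAu hnK hc (fun m =>
      C.sum_gaussMap_mul_linMap hp0 hg hz (hfix _ (G.pow_mem hσ m)) (hpow m)
        (C.linMap_ne_zero hli (hAu.pow m) 0))
    exact ⟨A, a, u, b, hAu, hA, ha, hAab, hu⟩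
  obtain ⟨⟨σ₀, hσ₀⟩, hne⟩ := Subgroup.ne_bot_iff_exists_ne_one.1 hnontrivial
  have hσ₀1 : σ₀ ≠ 1 := fun h => hne (Subtype.ext h)
  obtain ⟨A₀, a₀, u, b₀, -, hA₀, ha₀, hA₀b, hu⟩ := hom σ₀ hσ₀
  have hu0 : u ≠ 0 := by
    rintro rfl
    apply hσ₀1
    rw [Matrix.zero_vecMulVec, add_zero] at hA₀b
    rw [hA₀b] at hA₀
    refine C.eq_one_of_matrix_scalar ?_ ha₀ hA₀
    rw [← PlaneCurve.linMap_one]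
    exact C.linMap_ne_zero hli isUnit_one 2
  obtain ⟨S, hS⟩ := exists_GL_with_column hu0
  have hSu : (fun i => (S : Matrix (Fin 3) (Fin 3) K) i 0) = u := funext hS
  set R : Matrix (Fin 3) (Fin 3) K := ((S⁻¹ : GL (Fin 3) K) : Matrix (Fin 3) (Fin 3) K) with hR
  have hR2 : C.linMap R 2 ≠ 0 := C.linMap_ne_zero hli (Units.isUnit S⁻¹) 2
  have haff : ∀ σ ∈ G, σ (C.linRatio R 1 2) = C.linRatio R 1 2 ∧
      ∃ α β κ : K, σ (C.linRatio R 0 2) = α • C.linRatio R 0 2 + β • C.linRatio R 1 2 +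
        algebraMap K C.functionField κ := by
    intro σ hσ
    obtain ⟨A, a, u', b, hAu, hA, ha, hAb, hu'⟩ := hom σ hσ
    -- The centre of every other homology is proportional to that of σ₀; the factor κ is absorbed
    -- into `b` (κ = 0 is allowed).
    obtain ⟨κ, hκ⟩ := proportional_of_orthogonal hg hu0 hu hu'
    refine C.map_linRatio_of_homology hli S hAu hA ha (b := κ • b) ?_
    rw [hAb, hSu]
    congr 1
    ext i j
    simp only [Matrix.vecMulVec_apply, Pi.smul_apply, smul_eq_mul, hκ]
    ring
  obtain ⟨σ, ξ, b, c, hGσ, hξ, hσx⟩ := exists_generator_of_affine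
    (C.adjoin_linRatio_eq_top S hR2) (C.linRatio_linearIndependent hli S⁻¹) G hnontrivial hn hnK
    (fun σ hσ => (haff σ hσ).1) (fun σ hσ => (haff σ hσ).2)
  obtain ⟨T, hTu, hx, hy⟩ := C.exists_shear S hR2 b c
  have hT0 : C.tangentCoord T 0 = 0 := by
    rw [PlaneCurve.tangentCoord]
    simp_rw [hTu, hS]
    exact hu
  have hσG : σ ∈ G := hGσ.ge (Subgroup.mem_zpowers σ)
  refine ⟨T, ξ, σ, hT0, hξ, hGσ, ?_, ?_⟩
  · rw [hx, hσx]
  · rw [hy, (haff σ hσG).1]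

theorem mainTheorem7 {Fq K : Type*} [Field Fq] [Finite Fq] [Field K] [Algebra Fq K]
    [IsAlgClosure Fq K] (p : ℕ) [Fact p.Prime] [CharP Fq p] (hp : 2 < p)
    (C : PlaneCurve Fq K)
    (r : ℕ) (z : Fin 3 → C.functionField) (hz : C.IsSeparableGaussMap p r z)
    (G : Subgroup (C.functionField ≃ₐ[K] C.functionField))
    (hlin : ∀ σ ∈ G, C.IsLinear σ) (hnontrivial : G ≠ ⊥)
    (hsub : ratioField K z ≤ IntermediateField.fixedField G)
    (n : ℕ) (hn : Nat.card G = n) (hpn : ¬ p ∣ n) :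
    0 < r ∧
    ∃ (T : GL (Fin 3) K) (z₁ z₂ : MvPolynomial (Fin 2) K) (ξ : K)
      (σ : C.functionField ≃ₐ[K] C.functionField),
      Irreducible (C.affinePoly T) ∧
      C.affinePoly T ∣ substPow n z₁ ^ p ^ r * MvPolynomial.X 1 + substPow n z₂ ^ p ^ r ∧
      ¬ C.affinePoly T ∣ substPow n z₁ ∧
      IsPrimitiveRoot ξ n ∧
      G = Subgroup.zpowers σ ∧
      σ (C.linRatio ((T⁻¹ : GL (Fin 3) K) : Matrix (Fin 3) (Fin 3) K) 0 2) =
        algebraMap K C.functionField ξ *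
          C.linRatio ((T⁻¹ : GL (Fin 3) K) : Matrix (Fin 3) (Fin 3) K) 0 2 ∧
      σ (C.linRatio ((T⁻¹ : GL (Fin 3) K) : Matrix (Fin 3) (Fin 3) K) 1 2) =
        C.linRatio ((T⁻¹ : GL (Fin 3) K) : Matrix (Fin 3) (Fin 3) K) 1 2 := by
  have : IsAlgClosed K := IsAlgClosure.isAlgClosed Fq
  have : CharP K p := charP_of_injective_algebraMap (algebraMap Fq K).injective p
  have : Infinite K := IsAlgClosed.instInfinite
  have hp0 : p ≠ 0 := by omega
  have hnK : (n : K) ≠ 0 := fun h => hpn ((CharP.cast_eq_zero_iff K p n).1 h)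
  have hg := C.gaussMap_not_constant hp0 hz hnontrivial
  have hli := C.coord_linearIndependent hg
  have hfix : ∀ σ ∈ G, ∀ x ∈ ratioField K z, σ x = x := fun σ hσ x hx =>
    (IntermediateField.mem_fixedField_iff _ _).1 (hsub hx) σ hσ
  obtain ⟨T, ξ, σ, hT0, hξ, hGσ, hσx, hσy⟩ :=
    C.exists_homology_coordinates hp0 hg hli hz hlin hnontrivial hfix hn hnK
  have h2 := C.linMap_ne_zero hli (Units.isUnit T⁻¹) 2
  have hσG : σ ∈ G := hGσ.ge (Subgroup.mem_zpowers σ)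
  obtain ⟨w₁, hw₁, w₂, hw₂, hw₁0, hw⟩ := C.exists_tangent_equation hg hz T hT0 h2
  have htop := C.adjoin_linRatio_eq_top T h2
  -- K(γ_s(𝒳)) is fixed by σ, so w₁ and w₂ lie in K(x^n, y).
  have hm₁ := mem_adjoin_pow_of_fixed htop hnK hξ hσx hσy (hfix σ hσG _ hw₁)
  have hm₂ := mem_adjoin_pow_of_fixed htop hnK hξ hσx hσy (hfix σ hσG _ hw₂)
  obtain ⟨z₁, z₂, hdvd, hndvd⟩ :=
    C.exists_polynomials_of_tangent_equation T h2 hm₁ hm₂ hw₁0 hw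
  have hTQ : (T : Matrix (Fin 3) (Fin 3) K) *
      ((T⁻¹ : GL (Fin 3) K) : Matrix (Fin 3) (Fin 3) K) = 1 := by
    rw [← Units.val_mul, mul_inv_cancel, Units.val_one]
  have htT : ((T : Matrix (Fin 3) (Fin 3) K).map (algebraMap K C.CoordField)).mulVec
      (C.linMap ((T⁻¹ : GL (Fin 3) K) : Matrix (Fin 3) (Fin 3) K)) = C.coord := by
    rw [← PlaneCurve.linMap_mul, hTQ, PlaneCurve.linMap_one]
  refine ⟨C.pos_of_tangentCoord_eq_zero hg hz T hT0 h2, T, z₁, z₂, ξ, σ,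
    C.affinePoly_irreducible T htT h2, hdvd, hndvd, hξ, hGσ, ?_, hσy⟩
  rw [hσx, Algebra.smul_def]

end
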